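/- Terminology. A domain is a nonempty open connected subset of $\mathbb C$. Let $K\subset\mathbb C$ be compact. * A (local holomorphic) symmetry of $K$ on a domain $D$ with $D\cap K\ne\emptyset$ is a holomorphic map $H:D\to\mathbb C$ such that, for $x\in D$, $x\in D\cap K$ if and only if $H(x)\in H(D)\cap K$. A point $b\in D$ is an attracting fixed point of $H$ if $H(b)=b$ and $0<|H'(b)|<1$. * $K$ is J-like relative to a domain $U$ if the set of those points of $U\cap K$ that are attracting fixed points of local holomorphic symmetries of $K$ is dense in $U\cap K$; $K$ is J-like if it is J-like relative to some domain $U\supset K$. * $K$ is laminar relative to a domain $U$ with $U\cap K\neq\emptyset$ if every open subset of $U$ that intersects $K$ contains a simply connected domain $\Omega$ with $\Omega\cap K\ne\emptyset$ for which there are a compact set $L\subset i\mathbb R$ and an injective holomorphic map $\psi$ defined in a neighborhood of $\overline\Omega$ with $\psi(\overline\Omega\cap K)=[0,1]\times L:=\{t+s: t\in[0,1],\ s\in L\}$. $K$ is non-laminar if there is no such domain $U$. * A map $f:V\to\mathbb C$ on an open set $V\subset\mathbb C$ is conformal if it is locally injective and, on each connected component of $V$, holomorphic or anti-holomorphic (the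 choice may depend on the component). Theorem. Let $K\subset\mathbb C$ be a J-like, non-laminar compact set with no isolated points, and let $V$ be an open neighborhood of $K$ such that every connected component of $V$ intersects $K$. Then the set $$\mathcal I_V=\{f:V\to\mathbb C \mid f(K)=K,\ f \text{ conformal and injective}\}$$ is finite. -/

import Mathlib

open Set
open scoped Topology ComplexConjugate

namespace PlaneSymmetry

/-- A domain is a (nonempty) open connected subset of the plane. -/
def IsPlaneDomain (D : Set ℂ) : Prop := IsOpen D ∧ IsConnected D

/-- `H : D → ℂ` (only its values on `D` matter) is a local holomorphic symmetry of `K` on the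
domain `D`, where `D` meets `K`. -/
structure IsSymmetry (K D : Set ℂ) (H : ℂ → ℂ) : Prop where
  domain : IsPlaneDomain D
  meets : (D ∩ K).Nonempty
  holo : DifferentiableOn ℂ H D
  mem_iff : ∀ x ∈ D, x ∈ D ∩ K ↔ H x ∈ H '' D ∩ K

/-- `b ∈ D` is an attracting fixed point of `H : D → ℂ`: `H b = b` and `0 < |H'(b)| < 1`. -/
def IsAttractingFixedPt (D : Set ℂ) (H : ℂ → ℂ) (b : ℂ) : Prop :=
  b ∈ D ∧ H b = b ∧ 0 < ‖deriv H b‖ ∧ ‖deriv H b‖ < 1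

/-- All attracting fixed points of local holomorphic symmetries of `K`. -/
def attractingPts (K : Set ℂ) : Set ℂ :=
  {b | ∃ (D : Set ℂ) (H : ℂ → ℂ), IsSymmetry K D H ∧ IsAttractingFixedPt D H b}

/-- `K` is J-like relative to the domain `U`: the attracting fixed points of local holomorphic
symmetries of `K` (those lying in `U ∩ K`) are dense in `U ∩ K`. -/
def IsJLikeRel (K U : Set ℂ) : Prop :=
  IsPlaneDomain U ∧ U ∩ K ⊆ closure (attractingPts K ∩ (U ∩ K))

/-- `K` is J-like: it is J-like relative to some domain that is a neighborhood of `K`. -/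
def IsJLike (K : Set ℂ) : Prop := ∃ U : Set ℂ, K ⊆ U ∧ IsJLikeRel K U

/-- `closure Ω ∩ K` is analytically diffeomorphic to `[0,1] × L`: some `ψ`, holomorphic and
injective on a neighborhood `N` of `closure Ω`, maps it onto `[0,1] × L`, with `L ⊆ iℝ` compact
(here `L` is given as a subset of `ℝ`, and `s ×ℂ t = {z | re z ∈ s, im z ∈ t}`). -/
def IsProductOn (K Ω : Set ℂ) : Prop :=
  ∃ (N : Set ℂ) (ψ : ℂ → ℂ) (L : Set ℝ), IsOpen N ∧ closure Ω ⊆ N ∧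
    DifferentiableOn ℂ ψ N ∧ InjOn ψ N ∧ IsCompact L ∧
    ψ '' (closure Ω ∩ K) = Icc (0 : ℝ) 1 ×ℂ L

/-- `K` is laminar relative to the domain `U` (which meets `K`): every open subset of `U` meeting
`K` contains a simply connected domain `Ω`, meeting `K`, such that `closure Ω ∩ K` is
analytically diffeomorphic to a product `[0,1] × L`. -/
def IsLaminarRel (K U : Set ℂ) : Prop :=
  IsPlaneDomain U ∧ (U ∩ K).Nonempty ∧
    ∀ W : Set ℂ, IsOpen W → W ⊆ U → (W ∩ K).Nonempty →
      ∃ Ω : Set ℂ, Ω ⊆ W ∧ IsOpen Ω ∧ IsSimplyConnected Ω ∧ (Ω ∩ K).Nonempty ∧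
        IsProductOn K Ω

/-- `K` is non-laminar: it is laminar relative to no domain. -/
def IsNonLaminar (K : Set ℂ) : Prop := ∀ U : Set ℂ, ¬ IsLaminarRel K U

/-- `f` is conformal on the open set `V`: locally injective, and on each component of `V`
holomorphic or anti-holomorphic. -/
def IsConformalOn (f : ℂ → ℂ) (V : Set ℂ) : Prop :=
  ∀ x ∈ V, (∃ W ∈ 𝓝 x, InjOn f W) ∧
    (DifferentiableOn ℂ f (connectedComponentIn V x) ∨
      DifferentiableOn ℂ (fun z => conj (f z)) (connectedComponentIn V x))

/-- The set of conformal injective maps `g : V → ℂ` with `g(K) = K`, as functions on the subtype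
`V`; `f` is any extension of `g` to the plane. -/
def conformalSelfMaps (V K : Set ℂ) : Set (V → ℂ) :=
  {g | ∃ f : ℂ → ℂ, (fun x : V => f x) = g ∧ IsConformalOn f V ∧ InjOn f V ∧ f '' K = K}

end PlaneSymmetry

/-!
Suppose that there are infinitely many conformal self-maps of `(V, K)`. The contradiction comes
from producing arbitrarily small nontrivial local symmetries of `K` at an attracting point, and
from using the contraction there as a microscope that turns them into a local flow preserving `K`.

*Compactness.* An injective holomorphic function on a disc is bounded on a smaller disc in terms
of one omitted value (`norm_sub_le_of_omits`). A self-map omits, on the disc about `a ∈ K` with a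
point `x ∈ K` on its boundary, the value at `x`, which lies in `K`. Hence the self-maps are
uniformly bounded near `K`, and by Arzelà–Ascoli some sequence `f n` of them, pairwise distinct on
one component of `V`, converges to a limit `F` uniformly near every point of `K`
(`exists_subseq_tendstoUniformlyOn`).

*Nondegeneracy.* `F` is not locally constant at any point of `K`
(`ConvergesNear.not_locally_const`): since `F` maps `K` onto `K`, the part of `K` where it is
locally constant has finite image, and `K` has no isolated points, all of `K` is already covered by
the values of `F` at the remaining points; by a Hurwitz argument the injective maps `f n` leave no
room for a further point with the same value. So there is an attracting point `b` in the chosen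
component where the derivative of `F` (or of its conjugate) does not vanish, and the maps
`(f m)⁻¹ ∘ f n` are local symmetries of `K` on a fixed disc about `b`, different from the identity
and as close to it as desired (`ConvergesNear.exists_smallSym`).

*Zooming in.* In Koenigs' coordinate `b` is the origin, and `K` becomes a set `X` invariant under
multiplication by `l`, where `0 < ‖l‖ < 1`. If `g` is a small symmetry of `X` with `g 0 ≠ 0`, then
`z ↦ g (l ^ k * z) / l ^ k` is, by the Schwarz lemma, nearly the translation by `g 0 / l ^ k`, and
`k` can be chosen to give this translation any prescribed size up to the factor `‖l‖`. In the limit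
`X` is invariant under arbitrarily short translations, hence under a segment of translations in one
direction (`exists_translation_flow`); so `K` is laminar near `b` (`isLaminarRel_of_flow`).

If the small symmetries fix `b`, then rescaling each of them keeps it small and removes its other
fixed points from a fixed disc (`SmallSym.exists_forall_ne`). Another attracting point in this
disc is then moved by all of the rescaled symmetries, and the argument applies there
(`exists_isLaminarRel`).
-/

namespace PlaneSymmetry

/-! ### A distortion estimate for univalent functions -/

/-- A continuous square root of a nonvanishing holomorphic function is holomorphic. -/
theorem differentiableOn_of_sq {U : Set ℂ} (hU : IsOpen U) {G P : ℂ → ℂ}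
    (hG : ContinuousOn G U) (hP : DifferentiableOn ℂ P U) (hsq : ∀ z ∈ U, G z ^ 2 = P z)
    (h0 : ∀ z ∈ U, P z ≠ 0) : DifferentiableOn ℂ G U := by
  intro z hz
  have hGz : G z ≠ 0 := fun h => h0 z hz (by rw [← hsq z hz, h]; simp)
  have hcont : ContinuousAt G z := hG.continuousAt (hU.mem_nhds hz)
  have hd := (hP.differentiableAt (hU.mem_nhds hz)).hasDerivAt
  rw [hasDerivAt_iff_tendsto_slope] at hd
  refine DifferentiableAt.differentiableWithinAt (HasDerivAt.differentiableAt
    (f' := deriv P z * (G z + G z)⁻¹) ?_)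
  rw [hasDerivAt_iff_tendsto_slope]
  have hsum : Filter.Tendsto (fun w => (G w + G z)⁻¹) (𝓝[≠] z) (𝓝 (G z + G z)⁻¹) := by
    refine Filter.Tendsto.inv₀ (Filter.Tendsto.add_const _ (hcont.tendsto.mono_left inf_le_left)) ?_
    rw [← two_mul]; exact mul_ne_zero two_ne_zero hGz
  refine (hd.mul hsum).congr' ?_
  have h1 : ∀ᶠ w in 𝓝[≠] z, G w + G z ≠ 0 := by
    have : Filter.Tendsto (fun w => G w + G z) (𝓝[≠] z) (𝓝 (G z + G z)) :=
      Filter.Tendsto.add_const _ (hcont.tendsto.mono_left inf_le_left)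
    exact this.eventually_ne (by rw [← two_mul]; exact mul_ne_zero two_ne_zero hGz)
  filter_upwards [h1, mem_nhdsWithin_of_mem_nhds (hU.mem_nhds hz), self_mem_nhdsWithin]
    with w hw hwU hwz
  have hwz' : w - z ≠ 0 := sub_ne_zero.2 hwz
  rw [slope_def_field, slope_def_field, ← hsq w hwU, ← hsq z hz]
  field_simp
  ring

theorem isOpen_image_of_injOn {f : ℂ → ℂ} {a : ℂ} {s : ℝ}
    (hf : DifferentiableOn ℂ f (Metric.ball a s)) (hinj : InjOn f (Metric.ball a s))
    {u : Set ℂ} (hu : IsOpen u) (hus : u ⊆ Metric.ball a s) : IsOpen (f '' u) := by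
  rcases le_or_gt s 0 with hs | hs
  · rw [Metric.ball_eq_empty.2 hs, subset_empty_iff] at hus
    simp [hus]
  rcases (hf.analyticOnNhd Metric.isOpen_ball).is_constant_or_isOpen
    (convex_ball a s).isPreconnected with ⟨w, hw⟩ | h
  · exfalso
    have h1 : a ∈ Metric.ball a s := Metric.mem_ball_self hs
    have h2 : a + (s / 2 : ℝ) ∈ Metric.ball a s := by
      simp [abs_of_pos hs]; linarith
    have := hinj h1 h2 ((hw _ h1).trans (hw _ h2).symm)
    have h3 : ((s / 2 : ℝ) : ℂ) = 0 := by linear_combination -this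
    have : s / 2 = 0 := by exact_mod_cast h3
    linarith
  · exact h _ hus hu

/-- Preimages of connected sets under a univalent function are connected, the function being a
homeomorphism onto its open image. -/
theorem isPreconnected_inter_preimage {f : ℂ → ℂ} {a : ℂ} {s : ℝ} {S : Set ℂ}
    (hf : DifferentiableOn ℂ f (Metric.ball a s)) (hinj : InjOn f (Metric.ball a s))
    (hS : IsPreconnected S) (hSf : S ⊆ f '' Metric.ball a s) :
    IsPreconnected (Metric.ball a s ∩ f ⁻¹' S) := by
  have hopen : IsOpenMap ((Metric.ball a s).domRestrict f) := by
    intro u hu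
    obtain ⟨v, hv, rfl⟩ := isOpen_induced_iff.1 hu
    have : (Metric.ball a s).domRestrict f '' (Subtype.val ⁻¹' v) = f '' (Metric.ball a s ∩ v) := by
      ext y; constructor
      · rintro ⟨x, hx, rfl⟩; exact ⟨x, ⟨x.2, hx⟩, rfl⟩
      · rintro ⟨x, hx, rfl⟩; exact ⟨⟨x, hx.1⟩, hx.2, rfl⟩
    rw [this]
    exact isOpen_image_of_injOn hf hinj (Metric.isOpen_ball.inter hv) inter_subset_left
  have h := hS.preimage_of_isOpenMap (f := (Metric.ball a s).domRestrict f)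
    (injOn_iff_injective.1 hinj) hopen (by rwa [range_domRestrict])
  have h2 := h.image (Subtype.val) continuous_subtype_val.continuousOn
  convert h2 using 1
  ext y; constructor
  · rintro ⟨h1, h2⟩; exact ⟨⟨y, h1⟩, h2, rfl⟩
  · rintro ⟨x, hx, rfl⟩; exact ⟨x.2, hx⟩

/-- The normalized distortion estimate, in the spirit of Koebe's one-quarter theorem. A branch `G`
of `√(1 - F)` with `G a = 1` has positive real part on the connected set where `‖F‖ < 1`, so `G`
avoids a disc about `-1`; thus `(G + 1)⁻¹` is bounded, and the Schwarz lemma controls it near `a`.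
-/
theorem norm_le_of_omits_one {F : ℂ → ℂ} {a : ℂ} {s : ℝ} (hs : 0 < s)
    (hF : DifferentiableOn ℂ F (Metric.ball a s)) (hinj : InjOn F (Metric.ball a s))
    (h0 : F a = 0) (h1 : ∀ z ∈ Metric.ball a s, F z ≠ 1)
    (hsub : Metric.ball 0 1 ⊆ F '' Metric.ball a s) {z : ℂ} (hz : dist z a ≤ s / 20) :
    ‖F z‖ ≤ 17 := by
  have haB : a ∈ Metric.ball a s := Metric.mem_ball_self hs
  have hP : DifferentiableOn ℂ (fun z => 1 - F z) (Metric.ball a s) := hF.const_sub 1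
  have hP0 : ∀ z ∈ Metric.ball a s, 1 - F z ≠ 0 := fun z hz h => h1 z hz (sub_eq_zero.1 h).symm
  have hsc : IsSimplyConnected (Metric.ball a s) := by
    have : ContractibleSpace (Metric.ball a s) :=
      (convex_ball a s).contractibleSpace ⟨a, haB⟩
    exact SimplyConnectedSpace.ofContractible _
  obtain ⟨G₀, hG₀, hsq₀⟩ := Complex.exists_continuousOn_pow_eq hsc Metric.isOpen_ball
    hP.continuousOn (by rintro ⟨x, hx, h⟩; exact hP0 x hx h) two_ne_zero
  -- normalise the sign of the square root at the centre
  obtain ⟨G, hGc, hsq, hGa⟩ : ∃ G : ℂ → ℂ, ContinuousOn G (Metric.ball a s) ∧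
      (∀ z, G z ^ 2 = 1 - F z) ∧ G a = 1 := by
    have : G₀ a ^ 2 = 1 := by rw [hsq₀, h0, sub_zero]
    rcases mul_self_eq_one_iff.1 ((sq _).symm.trans this) with h | h
    · exact ⟨G₀, hG₀, hsq₀, h⟩
    · exact ⟨fun z => - G₀ z, hG₀.neg, fun z => by rw [neg_sq, hsq₀], by simp [h]⟩
  have hGd : DifferentiableOn ℂ G (Metric.ball a s) :=
    differentiableOn_of_sq Metric.isOpen_ball hGc hP (fun z _ => hsq z) hP0
  have hconn := isPreconnected_inter_preimage hF hinj (convex_ball (0 : ℂ) 1).isPreconnected hsub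
  have hre : ∀ z ∈ Metric.ball a s ∩ F ⁻¹' Metric.ball 0 1, 0 < (G z).re := by
    intro z hz
    by_contra hneg
    push Not at hneg
    have hcr : ContinuousOn (fun z => (G z).re) (Metric.ball a s ∩ F ⁻¹' Metric.ball 0 1) :=
      Complex.continuous_re.comp_continuousOn (hGc.mono inter_subset_left)
    obtain ⟨x, hx, hx0⟩ := hconn.intermediate_value hz
      (show a ∈ Metric.ball a s ∩ F ⁻¹' Metric.ball 0 1 from ⟨haB, by simp [h0]⟩) hcr
      (show (0 : ℝ) ∈ Icc _ _ from ⟨hneg, by simp [hGa]⟩)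
    have h2 : F x = 1 + ((G x).im ^ 2 : ℝ) := by
      have hx0' : (G x).re = 0 := hx0
      have : G x = (G x).im * Complex.I := by
        apply Complex.ext <;> simp [hx0']
      have h3 := hsq x
      rw [this, mul_pow, Complex.I_sq] at h3
      push_cast
      linear_combination h3
    have h4 : ‖F x‖ < 1 := by simpa using hx.2
    have h5 := (Complex.re_le_norm (F x)).trans_lt h4
    rw [h2] at h5
    have h6 : (1 + (((G x).im ^ 2 : ℝ) : ℂ)).re = 1 + (G x).im ^ 2 := by
      rw [Complex.add_re, Complex.ofReal_re, Complex.one_re]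
    rw [h6] at h5
    nlinarith [sq_nonneg (G x).im]
  have hom : ∀ z ∈ Metric.ball a s, 2 / 5 ≤ ‖G z + 1‖ := by
    intro z hz
    by_contra hlt
    push Not at hlt
    have h3 : ‖F z‖ < 1 := by
      have : F z = - ((G z + 1) * (G z + 1 - 2)) := by linear_combination hsq z
      rw [this, norm_neg, norm_mul]
      have h4 : ‖G z + 1 - 2‖ ≤ ‖G z + 1‖ + 2 := (norm_sub_le _ _).trans (by simp)
      nlinarith [norm_nonneg (G z + 1)]
    have h4 := hre z ⟨hz, by simpa using h3⟩
    have h5 := (Complex.re_le_norm (G z + 1)).trans_lt hlt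
    simp at h5
    linarith
  have hne : ∀ z ∈ Metric.ball a s, G z + 1 ≠ 0 := fun z hz h => by
    have := hom z hz; rw [h, norm_zero] at this; norm_num at this
  have hzB : z ∈ Metric.ball a s := Metric.mem_ball.2 (by linarith)
  have hM : DifferentiableOn ℂ (fun z => (G z + 1)⁻¹) (Metric.ball a s) :=
    (hGd.add_const 1).inv hne
  have hmaps : MapsTo (fun z => (G z + 1)⁻¹) (Metric.ball a s)
      (Metric.closedBall ((G a + 1)⁻¹) 3) := by
    intro w hw
    rw [mem_closedBall_iff_norm, hGa]
    have h1 : ‖(G w + 1)⁻¹‖ ≤ 5 / 2 := by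
      rw [norm_inv]
      exact (inv_anti₀ (by norm_num) (hom w hw)).trans (by norm_num)
    refine (norm_sub_le _ _).trans ?_
    have : ‖((1 : ℂ) + 1)⁻¹‖ = 1 / 2 := by norm_num
    rw [this]; linarith
  have hsch := Complex.dist_le_div_mul_dist_of_mapsTo_ball hM hmaps hzB
  have h7 : dist ((G z + 1)⁻¹) ((G a + 1)⁻¹) ≤ 3 / 20 := by
    refine hsch.trans ?_
    calc 3 / s * dist z a ≤ 3 / s * (s / 20) := by gcongr
      _ = 3 / 20 := by field_simp
  have h8 : 7 / 20 ≤ ‖(G z + 1)⁻¹‖ := by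
    have : ‖(G a + 1)⁻¹‖ = 1 / 2 := by rw [hGa]; norm_num
    rw [dist_comm, dist_eq_norm] at h7
    have := norm_sub_norm_le ((G a + 1)⁻¹) ((G z + 1)⁻¹)
    linarith
  have h9 : ‖G z + 1‖ ≤ 20 / 7 := by
    have h := inv_anti₀ (by norm_num) h8
    rw [norm_inv, inv_inv] at h
    exact h.trans (by norm_num)
  have h10 : ‖G z‖ ≤ 27 / 7 := by
    have : G z = G z + 1 - 1 := by ring
    rw [this]
    exact (norm_sub_le _ _).trans (by rw [norm_one]; linarith)
  have : F z = 1 - G z ^ 2 := by linear_combination hsq z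
  rw [this]
  refine (norm_sub_le _ _).trans ?_
  rw [norm_one, norm_pow]
  nlinarith [norm_nonneg (G z)]

/-- A univalent function is bounded on a smaller disc in terms of any value that it omits. -/
theorem norm_sub_le_of_omits {f : ℂ → ℂ} {a w : ℂ} {s : ℝ}
    (hf : DifferentiableOn ℂ f (Metric.ball a s)) (hinj : InjOn f (Metric.ball a s))
    (hw : w ∉ f '' Metric.ball a s) {z : ℂ} (hz : dist z a ≤ s / 20) :
    ‖f z - f a‖ ≤ 17 * ‖w - f a‖ := by
  rcases le_or_gt s 0 with hs | hs
  · have : dist z a = 0 := le_antisymm (hz.trans (by linarith)) dist_nonneg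
    rw [dist_eq_zero.1 this]; simp
  have haB : a ∈ Metric.ball a s := Metric.mem_ball_self hs
  have hopen := isOpen_image_of_injOn hf hinj Metric.isOpen_ball subset_rfl
  obtain ⟨w₀, hw₀, hdist⟩ := hopen.isClosed_compl.exists_infDist_eq_dist ⟨w, hw⟩ (f a)
  have hne : w₀ - f a ≠ 0 := fun h => hw₀ ⟨a, haB, (sub_eq_zero.1 h).symm⟩
  have hle : ‖w₀ - f a‖ ≤ ‖w - f a‖ := by
    rw [← dist_eq_norm, ← dist_eq_norm, dist_comm, dist_comm w, ← hdist]
    exact Metric.infDist_le_dist_of_mem hw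
  have hsub : Metric.ball (f a) ‖w₀ - f a‖ ⊆ f '' Metric.ball a s := by
    intro y hy
    by_contra hy'
    have := Metric.infDist_le_dist_of_mem (x := f a) (s := (f '' Metric.ball a s)ᶜ) hy'
    rw [hdist, dist_comm, dist_eq_norm, dist_comm] at this
    exact absurd hy (by rw [Metric.mem_ball]; linarith)
  have key := norm_le_of_omits_one (F := fun z => (f z - f a) / (w₀ - f a)) hs
    ((hf.sub_const _).div_const _)
    (fun x hx y hy h => hinj hx hy (by
      have h' : (f x - f a) / (w₀ - f a) = (f y - f a) / (w₀ - f a) := h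
      rw [div_left_inj' hne] at h'
      exact sub_left_injective h')) (by simp)
    (fun x hx h => hw₀ ⟨x, hx, by
      have h' : (f x - f a) / (w₀ - f a) = 1 := h
      rw [div_eq_one_iff_eq hne] at h'
      exact sub_left_injective h'⟩)
    (by
      intro u hu
      have hu' : ‖u‖ < 1 := by simpa using hu
      obtain ⟨x, hx, hxe⟩ := hsub (show f a + u * (w₀ - f a) ∈ _ by
        rw [mem_ball_iff_norm, add_sub_cancel_left, norm_mul]
        have := norm_pos_iff.2 hne
        nlinarith)
      exact ⟨x, hx, by simp only [hxe]; field_simp; ring⟩) hz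
  rw [norm_div, div_le_iff₀ (norm_pos_iff.2 hne)] at key
  linarith

/-! ### Small local symmetries, and how they transform under conjugation and rescaling -/

/-- `DiffContOnCl.ball_subset_image_closedBall` for a positive lower bound, which already excludes
that `f` is locally constant at `a`. -/
theorem ball_subset_image_closedBall {f : ℂ → ℂ} {a : ℂ} {r s ε : ℝ}
    (hf : DifferentiableOn ℂ f (Metric.ball a s)) (hr : 0 < r) (hrs : r < s) (hε : 0 < ε)
    (hsph : ∀ z ∈ Metric.sphere a r, ε ≤ ‖f z - f a‖) :
    Metric.ball (f a) (ε / 2) ⊆ f '' Metric.closedBall a r := by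
  have hcl : closure (Metric.ball a r) ⊆ Metric.ball a s :=
    Metric.closure_ball_subset_closedBall.trans (Metric.closedBall_subset_ball hrs)
  refine DiffContOnCl.ball_subset_image_closedBall (hf.mono hcl).diffContOnCl hr hsph ?_
  by_contra hcon
  rw [Filter.not_frequently] at hcon
  have hev : f =ᶠ[𝓝 a] fun _ => f a := by
    filter_upwards [hcon] with z hz using not_not.1 hz
  have hEq := (hf.analyticOnNhd Metric.isOpen_ball).eqOn_of_preconnected_of_eventuallyEq
    analyticOnNhd_const (convex_ball a s).isPreconnected
    (Metric.mem_ball_self (hr.trans hrs)) hev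
  have hm : a + (r : ℂ) ∈ Metric.sphere a r := by simp [abs_of_pos hr]
  have h1 := hsph _ hm
  rw [hEq (hcl (by rw [closure_ball a hr.ne']; exact Metric.sphere_subset_closedBall hm))] at h1
  simp at h1
  linarith

/-- `g` is an `ε`-small local symmetry of `K` on the disc of radius `r` about `b`: it is holomorphic
and `ε`-close to the identity there, and maps points of `K`, and only these, into `K`. Injectivity
is not demanded. -/
structure SmallSym (K : Set ℂ) (b : ℂ) (r ε : ℝ) (g : ℂ → ℂ) : Prop where
  holo : DifferentiableOn ℂ g (Metric.ball b r)
  close : ∀ x ∈ Metric.ball b r, ‖g x - x‖ < ε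
  mem_iff : ∀ x ∈ Metric.ball b r, x ∈ K ↔ g x ∈ K

theorem SmallSym.mono {K : Set ℂ} {b b' : ℂ} {r r' ε ε' : ℝ} {g : ℂ → ℂ}
    (h : SmallSym K b r ε g) (hr : Metric.ball b' r' ⊆ Metric.ball b r) (hε : ε ≤ ε') :
    SmallSym K b' r' ε' g :=
  ⟨h.holo.mono hr, fun x hx => (h.close x (hr hx)).trans_le hε, fun x hx => h.mem_iff x (hr hx)⟩

/-- `φ : W → W'` and `ζ : W' → W` are mutually inverse holomorphic maps of open sets. Both are
given as functions on `ℂ`, of which only the values on these sets matter. -/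
structure IsBiholomorphic (φ ζ : ℂ → ℂ) (W W' : Set ℂ) : Prop where
  open_source : IsOpen W
  open_target : IsOpen W'
  holo : DifferentiableOn ℂ φ W
  holo_inv : DifferentiableOn ℂ ζ W'
  mapsTo : MapsTo φ W W'
  mapsTo_inv : MapsTo ζ W' W
  left_inv : ∀ x ∈ W, ζ (φ x) = x
  right_inv : ∀ z ∈ W', φ (ζ z) = z

theorem IsBiholomorphic.symm {φ ζ : ℂ → ℂ} {W W' : Set ℂ} (h : IsBiholomorphic φ ζ W W') :
    IsBiholomorphic ζ φ W' W :=
  ⟨h.open_target, h.open_source, h.holo_inv, h.holo, h.mapsTo_inv, h.mapsTo, h.right_inv,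
    h.left_inv⟩

/-- Restriction to a smaller open subset of the target. -/
theorem IsBiholomorphic.restrict {φ ζ : ℂ → ℂ} {W W' S : Set ℂ} (h : IsBiholomorphic φ ζ W W')
    (hS : IsOpen S) (hSW : S ⊆ W') : IsBiholomorphic φ ζ (W ∩ φ ⁻¹' S) S where
  open_source := h.holo.continuousOn.isOpen_inter_preimage h.open_source hS
  open_target := hS
  holo := h.holo.mono inter_subset_left
  holo_inv := h.holo_inv.mono hSW
  mapsTo := fun _ hx => hx.2
  mapsTo_inv := fun z hz => ⟨h.mapsTo_inv (hSW hz), by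
    rw [mem_preimage, h.right_inv z (hSW hz)]; exact hz⟩
  left_inv := fun x hx => h.left_inv x hx.1
  right_inv := fun z hz => h.right_inv z (hSW hz)

/-- Conjugation by a biholomorphic map turns small symmetries of `K` at `b` into small symmetries
of the corresponding set `X` at `φ b`, on a disc that does not depend on the smallness. -/
theorem IsBiholomorphic.exists_conj_smallSym {φ ζ : ℂ → ℂ} {W W' K X : Set ℂ}
    (h : IsBiholomorphic φ ζ W W') (hKX : ∀ x ∈ W, x ∈ K ↔ φ x ∈ X) {b : ℂ} (hb : b ∈ W)
    {r : ℝ} (hr : 0 < r) :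
    ∃ r' > 0, Metric.ball (φ b) r' ⊆ W' ∧ MapsTo ζ (Metric.ball (φ b) r') (Metric.ball b r) ∧
      ∀ ε' > 0, ∃ ε > 0, ∀ g, SmallSym K b r ε g →
        SmallSym X (φ b) r' ε' (φ ∘ g ∘ ζ) ∧ ∀ z ∈ Metric.ball (φ b) r', g (ζ z) ∈ W := by
  obtain ⟨ρ, hρ, hρW⟩ := Metric.nhds_basis_closedBall.mem_iff.1 (h.open_source.mem_nhds hb)
  have hφb := h.mapsTo hb
  have hcont : ContinuousAt ζ (φ b) :=
    h.holo_inv.continuousOn.continuousAt (h.open_target.mem_nhds hφb)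
  have h1 : ζ ⁻¹' Metric.ball b (min (ρ / 2) r) ∈ 𝓝 (φ b) :=
    hcont.preimage_mem_nhds (by
      rw [h.left_inv b hb]; exact Metric.ball_mem_nhds _ (by positivity))
  obtain ⟨r', hr', hsub⟩ := Metric.mem_nhds_iff.1
    (Filter.inter_mem h1 (h.open_target.mem_nhds hφb))
  refine ⟨r', hr', fun z hz => (hsub hz).2, fun z hz =>
    Metric.ball_subset_ball (min_le_right _ _) (hsub hz).1, fun ε' hε' => ?_⟩
  have hunif := (isCompact_closedBall b ρ).uniformContinuousOn_of_continuous
    (h.holo.continuousOn.mono hρW)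
  obtain ⟨δ, hδ, hδ'⟩ := Metric.uniformContinuousOn_iff.1 hunif ε' hε'
  refine ⟨min δ (ρ / 2), by positivity, fun g hg => ?_⟩
  have key : ∀ z ∈ Metric.ball (φ b) r', ζ z ∈ Metric.ball b r ∧ ζ z ∈ Metric.closedBall b ρ ∧
      g (ζ z) ∈ Metric.closedBall b ρ ∧ dist (g (ζ z)) (ζ z) < δ := by
    intro z hz
    have h2 : ζ z ∈ Metric.ball b (min (ρ / 2) r) := (hsub hz).1
    have h3 := Metric.ball_subset_ball (min_le_right _ _) h2
    have h4 := hg.close _ h3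
    rw [← dist_eq_norm, lt_min_iff] at h4
    have h5 : dist (ζ z) b < ρ / 2 := (Metric.mem_ball.1 h2).trans_le (min_le_left _ _)
    refine ⟨h3, ?_, ?_, h4.1⟩
    · rw [Metric.mem_closedBall]; linarith
    · rw [Metric.mem_closedBall]
      linarith [dist_triangle (g (ζ z)) (ζ z) b]
  refine ⟨⟨?_, ?_, ?_⟩, fun z hz => hρW (key z hz).2.2.1⟩
  · refine h.holo.comp (hg.holo.comp (h.holo_inv.mono fun z hz => (hsub hz).2)
      fun z hz => (key z hz).1) fun z hz => hρW (key z hz).2.2.1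
  · intro z hz
    obtain ⟨k1, k2, k3, k4⟩ := key z hz
    have := hδ' _ k3 _ k2 k4
    rwa [h.right_inv z (hsub hz).2, dist_eq_norm] at this
  · intro z hz
    obtain ⟨k1, k2, k3, k4⟩ := key z hz
    have e1 := hKX _ (hρW k2)
    rw [h.right_inv z (hsub hz).2] at e1
    rw [← e1, hg.mem_iff _ k1, hKX _ (hρW k3)]
    rfl

theorem mem_iff_pow_mul_mem {X : Set ℂ} {R : ℝ} {l : ℂ} (hl : ‖l‖ < 1)
    (hX : ∀ z ∈ Metric.ball (0 : ℂ) R, z ∈ X ↔ l * z ∈ X) (k : ℕ) {z : ℂ}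
    (hz : z ∈ Metric.ball (0 : ℂ) R) : l ^ k * z ∈ Metric.ball (0 : ℂ) R ∧
      (z ∈ X ↔ l ^ k * z ∈ X) := by
  induction k with
  | zero => simpa using hz
  | succ k ih =>
    have h1 : l ^ (k + 1) * z = l * (l ^ k * z) := by ring
    rw [h1, ← hX _ ih.1]
    refine ⟨?_, ih.2⟩
    have h2 := ih.1
    rw [mem_ball_zero_iff] at h2 ⊢
    rw [norm_mul]
    exact (mul_le_of_le_one_left (norm_nonneg _) hl.le).trans_lt h2

/-- Rescaling by a power of `l` turns a small symmetry `g` of an `l`-invariant set into a symmetry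
that is close to the translation by `g 0 / l ^ k`. -/
theorem SmallSym.rescale {X : Set ℂ} {R ε : ℝ} {l : ℂ} {g : ℂ → ℂ}
    (hl0 : l ≠ 0) (hl : ‖l‖ < 1)
    (hX : ∀ z ∈ Metric.ball (0 : ℂ) R, z ∈ X ↔ l * z ∈ X) (h : SmallSym X 0 R ε g) (k : ℕ) :
    DifferentiableOn ℂ (fun z => g (l ^ k * z) / l ^ k) (Metric.ball 0 R) ∧
    (∀ z ∈ Metric.ball (0 : ℂ) R, ‖g (l ^ k * z) / l ^ k - z - g 0 / l ^ k‖ ≤ 2 * ε) ∧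
    (∀ z ∈ Metric.ball (0 : ℂ) R, g (l ^ k * z) / l ^ k ∈ Metric.ball (0 : ℂ) R →
      (z ∈ X ↔ g (l ^ k * z) / l ^ k ∈ X)) := by
  have hk : l ^ k ≠ 0 := pow_ne_zero _ hl0
  refine ⟨?_, ?_, ?_⟩
  · refine DifferentiableOn.div_const (h.holo.comp (by fun_prop) fun z hz => ?_) _
    exact (mem_iff_pow_mul_mem hl hX k hz).1
  · intro z hz
    have hR : 0 < R := (norm_nonneg z).trans_lt (mem_ball_zero_iff.1 hz)
    have hw := (mem_iff_pow_mul_mem hl hX k hz).1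
    have hd : DifferentiableOn ℂ (fun w => g w - w) (Metric.ball 0 R) :=
      h.holo.sub differentiableOn_id
    have hmaps : MapsTo (fun w => g w - w) (Metric.ball 0 R)
        (Metric.closedBall (g 0 - 0) (2 * ε)) := by
      intro w hw
      rw [mem_closedBall_iff_norm]
      refine (norm_sub_le _ _).trans ?_
      have h1 := h.close w hw
      have h2 := h.close 0 (Metric.mem_ball_self hR)
      linarith
    have hs := Complex.dist_le_div_mul_dist_of_mapsTo_ball hd hmaps hw
    rw [dist_eq_norm, dist_zero_right, norm_mul, sub_zero] at hs
    have e1 : g (l ^ k * z) / l ^ k - z - g 0 / l ^ k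
        = (g (l ^ k * z) - l ^ k * z - g 0) / l ^ k := by field_simp
    rw [e1, norm_div, div_le_iff₀ (norm_pos_iff.2 hk)]
    refine hs.trans ?_
    have hε : 0 < ε := (norm_nonneg _).trans_lt (h.close z hz)
    have hz' : ‖z‖ ≤ R := (mem_ball_zero_iff.1 hz).le
    rw [div_mul_eq_mul_div, div_le_iff₀ hR]
    have := norm_nonneg (l ^ k)
    calc 2 * ε * (‖l ^ k‖ * ‖z‖) ≤ 2 * ε * (‖l ^ k‖ * R) := by gcongr
      _ = _ := by ring
  · intro z hz hGz
    have e1 := mem_iff_pow_mul_mem hl hX k hz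
    have e2 := mem_iff_pow_mul_mem hl hX k hGz
    rw [mul_div_cancel₀ _ hk] at e2
    rw [e1.2, h.mem_iff _ e1.1, e2.2]

/-- If a small symmetry fixes `0` without being the identity, then rescaling it makes `0` its only
fixed point in a disc of given size. -/
theorem SmallSym.exists_forall_ne {X : Set ℂ} {R ε : ℝ} {l : ℂ} {g : ℂ → ℂ}
    (hl0 : l ≠ 0) (hl : ‖l‖ < 1) (hR : 0 < R) (hε : ε ≤ R / 4)
    (hX : ∀ z ∈ Metric.ball (0 : ℂ) R, z ∈ X ↔ l * z ∈ X) (h : SmallSym X 0 R ε g)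
    (h0 : g 0 = 0) (hne : ∃ z ∈ Metric.ball (0 : ℂ) R, g z ≠ z) :
    ∃ G, SmallSym X 0 (R / 2) (3 * ε) G ∧ ∀ z ∈ Metric.ball (0 : ℂ) R, z ≠ 0 → G z ≠ z := by
  have h0B : (0 : ℂ) ∈ Metric.ball (0 : ℂ) R := Metric.mem_ball_self hR
  have hεp : 0 < ε := (norm_nonneg _).trans_lt (h.close 0 h0B)
  have han := h.holo.analyticOnNhd Metric.isOpen_ball
  have hev : ∀ᶠ z in 𝓝[≠] (0 : ℂ), g z ≠ z := by
    rcases (han 0 h0B).eventually_eq_or_eventually_ne analyticAt_id with h1 | h1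
    · obtain ⟨z, hz, hgz⟩ := hne
      exact absurd (han.eqOn_of_preconnected_of_eventuallyEq analyticOnNhd_id
        (convex_ball _ _).isPreconnected h0B h1 hz) hgz
    · exact h1
  rw [eventually_nhdsWithin_iff, Metric.eventually_nhds_iff] at hev
  obtain ⟨τ, hτ, hfix⟩ := hev
  obtain ⟨k, hk⟩ := exists_pow_lt_of_lt_one (show 0 < τ / R by positivity) hl
  have hkne : l ^ k ≠ 0 := pow_ne_zero _ hl0
  obtain ⟨r1, r2, r3⟩ := h.rescale hl0 hl hX k
  simp only [h0, zero_div, sub_zero] at r2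
  have hsub : Metric.ball (0 : ℂ) (R / 2) ⊆ Metric.ball 0 R :=
    Metric.ball_subset_ball (by linarith)
  refine ⟨_, ⟨r1.mono hsub, fun z hz => (r2 z (hsub hz)).trans_lt (by linarith), fun z hz =>
    r3 z (hsub hz) ?_⟩, ?_⟩
  · rw [mem_ball_zero_iff] at hz ⊢
    have := r2 z (hsub (mem_ball_zero_iff.2 hz))
    have h2 := norm_le_norm_add_norm_sub' (g (l ^ k * z) / l ^ k) z
    linarith
  · intro z hz hz0 heq
    rw [div_eq_iff hkne, mul_comm z] at heq
    refine hfix (y := l ^ k * z) ?_ (mul_ne_zero hkne hz0) heq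
    rw [dist_zero_right, norm_mul, norm_pow]
    rw [mem_ball_zero_iff] at hz
    rw [lt_div_iff₀ hR] at hk
    have : 0 < ‖l‖ ^ k := by positivity
    nlinarith

/-! ### From small symmetries of a self-similar set to translations -/

theorem exists_scale {a η t : ℝ} (ha0 : 0 < a) (ha : a < 1) (ht : 0 < t) (htη : t ≤ η) :
    ∃ k : ℕ, a * η ≤ t / a ^ k ∧ t / a ^ k ≤ η := by
  have hη := ht.trans_le htη
  obtain ⟨k, h1, h2⟩ := exists_nat_pow_near_of_lt_one (div_pos ht hη)
    ((div_le_one hη).2 htη) ha0 ha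
  refine ⟨k, ?_, ?_⟩
  · rw [le_div_iff₀ (by positivity)]
    rw [lt_div_iff₀ hη, pow_succ] at h1
    nlinarith
  · rw [div_le_iff₀ (by positivity)]
    rwa [div_le_iff₀ hη, mul_comm] at h2

/-- The exponent `k` in `SmallSym.rescale` can be chosen so that the translation has size about `η`,
while the error is as small as desired. -/
theorem exists_approx_translation {X : Set ℂ} {R : ℝ} {l : ℂ} (hl0 : l ≠ 0) (hl : ‖l‖ < 1)
    (hX : ∀ z ∈ Metric.ball (0 : ℂ) R, z ∈ X ↔ l * z ∈ X)
    (hsm : ∀ ε > 0, ∃ g, SmallSym X 0 R ε g ∧ g 0 ≠ 0) (hR : 0 < R)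
    {η ε : ℝ} (hη : 0 < η) (hε : 0 < ε) :
    ∃ (G : ℂ → ℂ) (c : ℂ), ‖l‖ * η ≤ ‖c‖ ∧ ‖c‖ ≤ η ∧ DifferentiableOn ℂ G (Metric.ball 0 R) ∧
      (∀ z ∈ Metric.ball (0 : ℂ) R, ‖G z - z - c‖ ≤ ε) ∧
      (∀ z ∈ Metric.ball (0 : ℂ) R, G z ∈ Metric.ball (0 : ℂ) R → (z ∈ X ↔ G z ∈ X)) := by
  obtain ⟨g, hg, hg0⟩ := hsm (min (ε / 2) η) (by positivity)
  have h1 := hg.close 0 (Metric.mem_ball_self hR)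
  rw [sub_zero, lt_min_iff] at h1
  obtain ⟨k, hk1, hk2⟩ := exists_scale (norm_pos_iff.2 hl0) hl (norm_pos_iff.2 hg0) h1.2.le
  obtain ⟨r1, r2, r3⟩ := hg.rescale hl0 hl hX k
  refine ⟨_, g 0 / l ^ k, ?_, ?_, r1, fun z hz => (r2 z hz).trans ?_, r3⟩
  · rwa [norm_div, norm_pow]
  · rwa [norm_div, norm_pow]
  · linarith [min_le_left (ε / 2) η]

/-- An `l`-invariant set with arbitrarily small symmetries moving `0` has translational symmetries
of any small size, up to the factor `‖l‖`. -/
theorem exists_translation {X : Set ℂ} {R : ℝ} {l : ℂ} (hl0 : l ≠ 0) (hl : ‖l‖ < 1)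
    (hX : ∀ z ∈ Metric.ball (0 : ℂ) R, z ∈ X ↔ l * z ∈ X)
    (hcl : closure X ∩ Metric.ball 0 R ⊆ X)
    (hsm : ∀ ε > 0, ∃ g, SmallSym X 0 R ε g ∧ g 0 ≠ 0)
    {η : ℝ} (hη : 0 < η) (hηR : η ≤ R / 4) :
    ∃ c : ℂ, ‖l‖ * η ≤ ‖c‖ ∧ ‖c‖ ≤ η ∧
      ∀ z ∈ Metric.ball (0 : ℂ) (R / 2), z ∈ X ↔ z + c ∈ X := by
  have hR : 0 < R := by linarith
  have hseq := fun n : ℕ => exists_approx_translation hl0 hl hX hsm hR hη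
    (show (0 : ℝ) < 1 / (n + 1) by positivity)
  choose G c hc1 hc2 hGd hGc hGX using hseq
  obtain ⟨c₀, -, u, hu, hlim⟩ := (isCompact_closedBall (0 : ℂ) η).tendsto_subseq
    (fun n => mem_closedBall_zero_iff.2 (hc2 n))
  have hnorm := hlim.norm
  have hc₀ : ‖c₀‖ ≤ η := le_of_tendsto' hnorm fun n => hc2 _
  refine ⟨c₀, ge_of_tendsto' hnorm fun n => hc1 _, hc₀, ?_⟩
  have hε : Filter.Tendsto (fun n => (1 : ℝ) / ((u n : ℕ) + 1)) Filter.atTop (𝓝 0) :=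
    tendsto_one_div_add_atTop_nhds_zero_nat.comp hu.tendsto_atTop
  -- uniform convergence to the translation
  have happ : ∀ δ > 0, ∀ᶠ n in Filter.atTop, ∀ z ∈ Metric.ball (0 : ℂ) R,
      ‖G (u n) z - (z + c₀)‖ < δ := by
    intro δ hδ
    have e1 := hε.eventually_lt_const (half_pos hδ)
    have e2 := (Metric.tendsto_nhds.1 hlim) (δ / 2) (half_pos hδ)
    filter_upwards [e1, e2] with n h1 h2 z hz
    have h3 := hGc (u n) z hz
    rw [dist_eq_norm] at h2
    have : G (u n) z - (z + c₀) = (G (u n) z - z - c (u n)) + (c (u n) - c₀) := by ring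
    rw [this]
    refine (norm_add_le _ _).trans_lt ?_
    have h2' : ‖c (u n) - c₀‖ < δ / 2 := h2
    linarith
  intro z hz
  have hzR : z ∈ Metric.ball (0 : ℂ) R := Metric.ball_subset_ball (by linarith) hz
  have hzc : z + c₀ ∈ Metric.ball (0 : ℂ) R := by
    rw [mem_ball_zero_iff] at hz ⊢
    exact (norm_add_le _ _).trans_lt (by linarith)
  constructor
  · intro hzX
    refine hcl ⟨?_, hzc⟩
    have ht : Filter.Tendsto (fun n => G (u n) z) Filter.atTop (𝓝 (z + c₀)) := by
      rw [Metric.tendsto_nhds]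
      intro δ hδ
      filter_upwards [happ δ hδ] with n hn
      rw [dist_eq_norm]; exact hn z hzR
    refine mem_closure_of_tendsto ht ?_
    filter_upwards [ht (Metric.isOpen_ball.mem_nhds hzc)] with n hn
    exact (hGX _ z hzR hn).1 hzX
  · intro hzX
    refine hcl ⟨?_, hzR⟩
    rw [Metric.mem_closure_iff]
    intro δ hδ
    -- solve `G w = z + c₀` with `w` close to `z`
    have hzn := mem_ball_zero_iff.1 hz
    set ρ := min (δ / 2) (R / 4) with hρ
    have hρ0 : 0 < ρ := by positivity
    have hρR : ρ ≤ R / 4 := min_le_right _ _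
    have hsub : Metric.ball z (R / 2) ⊆ Metric.ball 0 R := fun w hw => by
      rw [mem_ball_iff_norm] at hw
      rw [mem_ball_zero_iff]
      have := norm_le_norm_add_norm_sub' w z
      linarith
    obtain ⟨n, hn⟩ := (happ (ρ / 8) (by positivity)).exists
    have hz' := hn z hzR
    have himg := ball_subset_image_closedBall (f := G (u n)) (a := z) (s := R / 2) (r := ρ)
      (ε := ρ / 2) ((hGd _).mono hsub) hρ0 (by linarith) (by positivity) (by
        intro w hw
        have hwn : ‖w - z‖ = ρ := by rw [← dist_eq_norm]; exact hw
        have hwR : w ∈ Metric.ball (0 : ℂ) R := hsub (by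
          rw [mem_ball_iff_norm, hwn]; linarith)
        have h1 := hn w hwR
        have : w - z = (G (u n) w - G (u n) z) - (G (u n) w - (w + c₀))
            + (G (u n) z - (z + c₀)) := by ring
        have h2 : ‖w - z‖ ≤ ‖G (u n) w - G (u n) z‖ + ‖G (u n) w - (w + c₀)‖
            + ‖G (u n) z - (z + c₀)‖ := by
          conv_lhs => rw [this]
          exact (norm_add_le _ _).trans (add_le_add_left (norm_sub_le _ _) _)
        rw [hwn] at h2
        linarith)
    obtain ⟨w, hw, hwe⟩ := himg (show z + c₀ ∈ _ by
      rw [mem_ball_iff_norm, norm_sub_rev]; linarith)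
    rw [mem_closedBall_iff_norm] at hw
    have hwR : w ∈ Metric.ball (0 : ℂ) R := hsub (by rw [mem_ball_iff_norm]; linarith)
    refine ⟨w, (hGX (u n) w hwR (by rwa [hwe])).2 (by rwa [hwe]), ?_⟩
    rw [dist_comm, dist_eq_norm]
    linarith [min_le_left (δ / 2) (R / 4)]

theorem iterate_translation {X : Set ℂ} {R : ℝ} {c : ℂ}
    (h : ∀ z ∈ Metric.ball (0 : ℂ) R, z ∈ X ↔ z + c ∈ X) {z : ℂ} (hz : z ∈ X) (j : ℕ)
    (hj : ‖z‖ + j * ‖c‖ < R) : z + j * c ∈ X ∧ z - j * c ∈ X := by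
  induction j with
  | zero => simpa using hz
  | succ j ih =>
    push_cast at hj
    have hc := norm_nonneg c
    obtain ⟨i1, i2⟩ := ih (by linarith)
    have hjc : ‖(j : ℂ) * c‖ = j * ‖c‖ := by rw [norm_mul]; simp
    constructor
    · have := (h (z + j * c) (by
        rw [mem_ball_zero_iff]
        refine (norm_add_le _ _).trans_lt ?_
        rw [hjc]; linarith)).1 i1
      convert this using 1; push_cast; ring
    · refine (h (z - (j + 1 : ℕ) * c) ?_).2 ?_
      · rw [mem_ball_zero_iff]
        refine (norm_sub_le _ _).trans_lt ?_
        rw [norm_mul, Complex.norm_natCast]; push_cast; linarith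
      · convert i2 using 1; push_cast; ring

/-- Multiples of shorter and shorter translations accumulate at a segment of translations in a
single direction `d`. -/
theorem exists_translation_flow {X : Set ℂ} {R : ℝ} {l : ℂ} (hl0 : l ≠ 0) (hl : ‖l‖ < 1)
    (hR : 0 < R)
    (hX : ∀ z ∈ Metric.ball (0 : ℂ) R, z ∈ X ↔ l * z ∈ X)
    (hcl : closure X ∩ Metric.ball 0 R ⊆ X)
    (hsm : ∀ ε > 0, ∃ g, SmallSym X 0 R ε g ∧ g 0 ≠ 0) :
    ∃ d : ℂ, ‖d‖ = 1 ∧ ∀ z ∈ Metric.ball (0 : ℂ) (R / 8), z ∈ X → ∀ t : ℝ, |t| < R / 8 →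
      z + t * d ∈ X := by
  have hseq := fun n : ℕ => exists_translation (η := R / 4 * (1 / ((n : ℝ) + 1)))
    hl0 hl hX hcl hsm (by positivity) (by
      refine mul_le_of_le_one_right (by positivity) ?_
      rw [div_le_one (by positivity)]; linarith [(Nat.cast_nonneg n : (0 : ℝ) ≤ n)])
  choose c hc1 hc2 hcX using hseq
  have hlp := norm_pos_iff.2 hl0
  have hcpos : ∀ n, 0 < ‖c n‖ := fun n => lt_of_lt_of_le (by positivity) (hc1 n)
  have hc0 : Filter.Tendsto (fun n => ‖c n‖) Filter.atTop (𝓝 0) := by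
    refine squeeze_zero (fun n => norm_nonneg _) hc2 ?_
    simpa using tendsto_one_div_add_atTop_nhds_zero_nat.const_mul (R / 4)
  obtain ⟨d, hd, u, hu, hlim⟩ := (isCompact_sphere (0 : ℂ) 1).tendsto_subseq
    (x := fun n => c n / ‖c n‖) (fun n => by
      rw [mem_sphere_zero_iff_norm, norm_div, Complex.norm_real, norm_norm,
        div_self (hcpos n).ne'])
  refine ⟨d, mem_sphere_zero_iff_norm.1 hd, fun z hz hzX t ht => ?_⟩
  rw [mem_ball_zero_iff] at hz
  have hfl : Filter.Tendsto (fun n => (⌊|t| / ‖c (u n)‖⌋₊ : ℝ) * ‖c (u n)‖) Filter.atTop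
      (𝓝 |t|) := by
    have hcu := hc0.comp hu.tendsto_atTop
    refine tendsto_of_tendsto_of_tendsto_of_le_of_le
      (g := fun n => |t| - ‖c (u n)‖) (h := fun _ => |t|) ?_ tendsto_const_nhds ?_ ?_
    · simpa using (tendsto_const_nhds (x := |t|)).sub hcu
    · intro n
      have h1 := Nat.lt_floor_add_one (|t| / ‖c (u n)‖)
      rw [div_lt_iff₀ (hcpos _)] at h1
      simp only
      linarith
    · intro n
      have h1 := Nat.floor_le (show 0 ≤ |t| / ‖c (u n)‖ by positivity)
      rwa [le_div_iff₀ (hcpos _)] at h1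
  have hmem : ∀ n, z + (⌊|t| / ‖c (u n)‖⌋₊ : ℂ) * c (u n) ∈ X ∧
      z - (⌊|t| / ‖c (u n)‖⌋₊ : ℂ) * c (u n) ∈ X := by
    intro n
    have h1 := Nat.floor_le (show 0 ≤ |t| / ‖c (u n)‖ by positivity)
    rw [le_div_iff₀ (hcpos _)] at h1
    refine iterate_translation (hcX (u n)) hzX _ ?_
    linarith
  have hlim2 : Filter.Tendsto (fun n => (⌊|t| / ‖c (u n)‖⌋₊ : ℂ) * c (u n)) Filter.atTop
      (𝓝 (|t| * d)) := by
    have := ((Complex.continuous_ofReal.tendsto _).comp hfl).mul hlim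
    refine this.congr fun n => ?_
    have : (‖c (u n)‖ : ℂ) ≠ 0 := by exact_mod_cast (hcpos _).ne'
    simp only [Function.comp_apply]
    push_cast
    field_simp
  have hball : ∀ s : ℝ, |s| < R / 8 → z + s * d ∈ Metric.ball (0 : ℂ) R := by
    intro s hs
    rw [mem_ball_zero_iff]
    refine (norm_add_le _ _).trans_lt ?_
    rw [norm_mul, Complex.norm_real, Real.norm_eq_abs, mem_sphere_zero_iff_norm.1 hd]
    linarith
  refine hcl ⟨?_, hball t ht⟩
  rcases abs_choice t with h | h
  · rw [h] at hlim2
    refine mem_closure_of_tendsto (hlim2.const_add z) (Filter.Eventually.of_forall fun n => ?_)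
    have := (hmem n).1; rwa [h] at this
  · rw [h] at hlim2
    have h3 := hlim2.const_sub z
    have e : z - ((-t : ℝ) : ℂ) * d = z + t * d := by push_cast; ring
    rw [e] at h3
    refine mem_closure_of_tendsto h3 (Filter.Eventually.of_forall fun n => ?_)
    have := (hmem n).2; rwa [h] at this

/-! ### A translation-invariant set is laminar -/

theorem IsBiholomorphic.image_eq {φ ζ : ℂ → ℂ} {W W' : Set ℂ} (h : IsBiholomorphic φ ζ W W') :
    ζ '' W' = W :=
  Subset.antisymm (image_subset_iff.2 h.mapsTo_inv)
    fun x hx => ⟨φ x, h.mapsTo hx, h.left_inv x hx⟩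

theorem isSimplyConnected_image_of_convex {f g : ℂ → ℂ} {S : Set ℂ} (hS : Convex ℝ S)
    (hne : S.Nonempty) (hf : ContinuousOn f S) (hg : ContinuousOn g (f '' S))
    (hgf : ∀ x ∈ S, g (f x) = x) : IsSimplyConnected (f '' S) := by
  have hmaps : MapsTo g (f '' S) S := by
    rintro _ ⟨x, hx, rfl⟩; rwa [hgf x hx]
  let e : S ≃ₜ (f '' S : Set ℂ) :=
    { toFun := (mapsTo_image f S).restrict
      invFun := hmaps.restrict
      left_inv := fun x => Subtype.ext (hgf x x.2)
      right_inv := by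
        rintro ⟨_, x, hx, rfl⟩
        exact Subtype.ext (congrArg f (hgf x hx))
      continuous_toFun := hf.mapsToRestrict (mapsTo_image f S)
      continuous_invFun := hg.mapsToRestrict hmaps }
  have : ContractibleSpace S := hS.contractibleSpace hne
  have : ContractibleSpace (f '' S : Set ℂ) := e.symm.contractibleSpace
  exact SimplyConnectedSpace.ofContractible _

theorem norm_sub_half_le {w : ℂ} (hw : w ∈ Icc (0 : ℝ) 1 ×ℂ Icc (-(1 / 2) : ℝ) (1 / 2)) :
    ‖w - 1 / 2‖ ≤ 1 := by
  rw [Complex.mem_reProdIm] at hw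
  refine (Complex.norm_le_abs_re_add_abs_im _).trans ?_
  have h1 : |(w - 1 / 2).re| ≤ 1 / 2 := by
    rw [abs_le]; simp; constructor <;> linarith [hw.1.1, hw.1.2]
  have h2 : |(w - 1 / 2).im| ≤ 1 / 2 := by
    rw [abs_le]; simp; constructor <;> linarith [hw.2.1, hw.2.2]
  linarith

/-- If in the coordinate `φ` the set `K` is invariant under short translations in the direction
`d`, then small squares with a side parallel to `d` show that `K` is laminar. -/
theorem isLaminarRel_of_flow {φ ζ : ℂ → ℂ} {W K : Set ℂ} {R : ℝ} {d : ℂ}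
    (h : IsBiholomorphic φ ζ W (Metric.ball 0 R)) (hK : IsClosed K) (hWK : (W ∩ K).Nonempty)
    (hd : ‖d‖ = 1)
    (hflow : ∀ z ∈ Metric.ball (0 : ℂ) R, ζ z ∈ K → ∀ t : ℝ, |t| < R →
      z + t * d ∈ Metric.ball (0 : ℂ) R → ζ (z + t * d) ∈ K) :
    IsLaminarRel K W := by
  have hd0 : d ≠ 0 := fun h0 => by rw [h0, norm_zero] at hd; exact zero_ne_one hd
  refine ⟨⟨h.open_source, ?_⟩, hWK, ?_⟩
  · refine ⟨hWK.mono inter_subset_left, ?_⟩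
    rw [← h.image_eq]
    exact (convex_ball _ _).isPreconnected.image _ h.holo_inv.continuousOn
  rintro W₀ hW₀ hW₀W ⟨x₀, hx₀, hx₀K⟩
  have hx₀W := hW₀W hx₀
  set z₀ := φ x₀ with hz₀
  have hz₀B : z₀ ∈ Metric.ball (0 : ℂ) R := h.mapsTo hx₀W
  have hζz₀ : ζ z₀ = x₀ := h.left_inv _ hx₀W
  have hR : 0 < R := (norm_nonneg _).trans_lt (mem_ball_zero_iff.1 hz₀B)
  have hnhds : Metric.ball (0 : ℂ) R ∩ ζ ⁻¹' W₀ ∈ 𝓝 z₀ :=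
    (h.holo_inv.continuousOn.isOpen_inter_preimage h.open_target hW₀).mem_nhds
      ⟨hz₀B, by rw [mem_preimage, hζz₀]; exact hx₀⟩
  obtain ⟨δ, hδ, hδsub⟩ := Metric.nhds_basis_closedBall.mem_iff.1 hnhds
  set ρ := min δ (R / 2) with hρ
  have hρ0 : 0 < ρ := by positivity
  have hρd : (ρ : ℂ) * d ≠ 0 := mul_ne_zero (by exact_mod_cast hρ0.ne') hd0
  -- the affine chart of a square around `z₀`, with one side parallel to `d`
  set A : ℂ → ℂ := fun w => z₀ + ρ * d * (w - 1 / 2) with hA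
  have hAcont : Continuous A := by fun_prop
  set S : Set ℂ := Ioo (0 : ℝ) 1 ×ℂ Ioo (-(1 / 2) : ℝ) (1 / 2) with hS
  set Sc : Set ℂ := Icc (0 : ℝ) 1 ×ℂ Icc (-(1 / 2) : ℝ) (1 / 2) with hSc
  have hSSc : S ⊆ Sc := fun w hw => ⟨Ioo_subset_Icc_self hw.1, Ioo_subset_Icc_self hw.2⟩
  have hclS : closure S = Sc := by
    rw [hS, Complex.closure_reProdIm, closure_Ioo (by norm_num), closure_Ioo (by norm_num)]
  have hSopen : IsOpen S := isOpen_Ioo.reProdIm isOpen_Ioo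
  have hScc : IsCompact Sc := isCompact_Icc.reProdIm isCompact_Icc
  have hSconv : Convex ℝ S :=
    ((convex_Ioo _ _).linear_preimage Complex.reLm).inter
      ((convex_Ioo _ _).linear_preimage Complex.imLm)
  have hAmem : ∀ w ∈ Sc, A w ∈ Metric.ball (0 : ℂ) R ∩ ζ ⁻¹' W₀ := by
    intro w hw
    refine hδsub ?_
    rw [mem_closedBall_iff_norm, hA]
    simp only [add_sub_cancel_left, norm_mul, hd, Complex.norm_real, Real.norm_eq_abs,
      abs_of_pos hρ0, mul_one]
    calc ρ * ‖w - 1 / 2‖ ≤ ρ * 1 := by gcongr; exact norm_sub_half_le hw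
      _ ≤ δ := by rw [mul_one]; exact min_le_left _ _
  set f : ℂ → ℂ := fun w => ζ (A w) with hf
  set ψ : ℂ → ℂ := fun x => (φ x - z₀) / (ρ * d) + 1 / 2 with hψ
  have hψf : ∀ w ∈ Sc, ψ (f w) = w := by
    intro w hw
    simp only [hψ, hf]
    rw [h.right_inv _ (hAmem w hw).1]
    simp only [hA]
    rw [add_sub_cancel_left, mul_div_cancel_left₀ _ hρd]; ring
  have hfW : MapsTo f Sc W := fun w hw => hW₀W (hAmem w hw).2
  have hfc : ContinuousOn f Sc :=
    h.holo_inv.continuousOn.comp hAcont.continuousOn fun w hw => (hAmem w hw).1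
  have hψd : DifferentiableOn ℂ ψ W := ((h.holo.sub_const _).div_const _).add_const _
  have hψinj : InjOn ψ W := by
    intro x hx y hy hxy
    have h1 : (φ x - z₀) / (ρ * d) = (φ y - z₀) / (ρ * d) := add_right_cancel hxy
    rw [div_left_inj' hρd] at h1
    rw [← h.left_inv x hx, ← h.left_inv y hy, sub_left_injective h1]
  have hclf : closure (f '' S) = f '' Sc := by
    refine Subset.antisymm ?_ ?_
    · exact closure_minimal (image_mono hSSc) (hScc.image_of_continuousOn hfc).isClosed
    · rw [← hclS] at hfc ⊢
      exact hfc.image_closure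
  have hhalf : (1 / 2 : ℂ) ∈ S := by
    rw [hS, Complex.mem_reProdIm]; norm_num
  have hAhalf : A (1 / 2) = z₀ := by simp [hA]
  refine ⟨f '' S, ?_, ?_, ?_, ?_, ?_⟩
  · rintro _ ⟨w, hw, rfl⟩; exact (hAmem w (hSSc hw)).2
  · -- the image is the preimage of the square under the chart `ψ`
    have : f '' S = W ∩ ψ ⁻¹' S := by
      ext x; constructor
      · rintro ⟨w, hw, rfl⟩
        exact ⟨hfW (hSSc hw), by rw [mem_preimage, hψf w (hSSc hw)]; exact hw⟩
      · rintro ⟨hx, hxS⟩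
        refine ⟨ψ x, hxS, hψinj (hfW (hSSc hxS)) hx (hψf _ (hSSc hxS))⟩
    rw [this]
    exact hψd.continuousOn.isOpen_inter_preimage h.open_source hSopen
  · refine isSimplyConnected_image_of_convex (g := ψ) hSconv ⟨_, hhalf⟩ (hfc.mono hSSc) ?_
      fun w hw => hψf w (hSSc hw)
    exact hψd.continuousOn.mono (image_subset_iff.2 fun w hw => hfW (hSSc hw))
  · exact ⟨x₀, ⟨1 / 2, hhalf, by simp only [hf]; rw [hAhalf, hζz₀]⟩, hx₀K⟩
  · set c : ℝ → ℂ := fun t => 1 / 2 + t * Complex.I with hc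
    have hcmem : ∀ t ∈ Icc (-(1 / 2) : ℝ) (1 / 2), c t ∈ Sc := by
      intro t ht
      rw [hSc, Complex.mem_reProdIm]
      simp only [hc]
      simp
      norm_num
      constructor <;> linarith [ht.1, ht.2]
    -- translating along the real direction of the square does not leave `K`
    have hmove : ∀ w ∈ Sc, ∀ w' ∈ Sc, w.im = w'.im → f w ∈ K → f w' ∈ K := by
      intro w hw w' hw' him hwK
      have e : A w' = A w + (ρ * (w'.re - w.re) : ℝ) * d := by
        have : w' - w = ((w'.re - w.re : ℝ) : ℂ) := by
          apply Complex.ext <;> simp [him]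
        simp only [hA]
        push_cast at this ⊢
        linear_combination ρ * d * this
      have h1 := hflow (A w) (hAmem w hw).1 hwK (ρ * (w'.re - w.re)) (by
        rw [abs_mul, abs_of_pos hρ0]
        have h2 : |w'.re - w.re| ≤ 1 := by
          rw [abs_le]; constructor <;> linarith [hw.1.1, hw.1.2, hw'.1.1, hw'.1.2]
        have h3 : ρ ≤ R / 2 := min_le_right _ _
        nlinarith) (by rw [← e]; exact (hAmem w' hw').1)
      rwa [← e] at h1
    refine ⟨W, ψ, Icc (-(1 / 2) : ℝ) (1 / 2) ∩ (fun t => f (c t)) ⁻¹' K, h.open_source, ?_, hψd,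
      hψinj, ?_, ?_⟩
    · rw [hclf]; rintro _ ⟨w, hw, rfl⟩; exact hfW hw
    · refine isCompact_Icc.of_isClosed_subset ?_ inter_subset_left
      refine ContinuousOn.preimage_isClosed_of_isClosed ?_ isClosed_Icc hK
      exact hfc.comp (by fun_prop) hcmem
    · rw [hclf]
      ext w
      constructor
      · rintro ⟨_, ⟨⟨v, hv, rfl⟩, hvK⟩, rfl⟩
        rw [hψf v hv]
        refine ⟨hv.1, hv.2, hmove v hv _ (hcmem _ hv.2) ?_ hvK⟩
        simp [hc]
      · rintro ⟨hw1, hw2, hwK⟩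
        have hw : w ∈ Sc := ⟨hw1, hw2⟩
        exact ⟨f w, ⟨⟨w, hw, rfl⟩, hmove _ (hcmem _ hw2) w hw (by simp [hc]) hwK⟩, hψf w hw⟩

/-! ### Koenigs' linearization at an attracting fixed point -/

theorem exists_quadratic_bound {D : Set ℂ} {H : ℂ → ℂ} {b : ℂ} (hD : IsOpen D)
    (hH : DifferentiableOn ℂ H D) (hb : b ∈ D) (hfix : H b = b) {s : ℝ}
    (hs : ‖deriv H b‖ < s) :
    ∃ r > 0, ∃ C > 0, Metric.ball b r ⊆ D ∧ ∀ x ∈ Metric.ball b r,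
      ‖H x - b‖ ≤ s * ‖x - b‖ ∧ ‖H x - b - deriv H b * (x - b)‖ ≤ C * ‖x - b‖ ^ 2 := by
  have hder := (hH.differentiableAt (hD.mem_nhds hb)).hasDerivAt
  have hlo := hasDerivAt_iff_isLittleO.1 hder
  have hev := hlo.bound (sub_pos.2 hs)
  set h : ℂ → ℂ := fun x => H x - deriv H b * (x - b) with hh
  have hhb : h b = b := by simp [hh, hfix]
  have hcont : ContinuousAt h b := by
    have := hder.continuousAt
    fun_prop
  have hball : h ⁻¹' Metric.closedBall (h b) 1 ∈ 𝓝 b :=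
    hcont.preimage_mem_nhds (Metric.closedBall_mem_nhds _ one_pos)
  obtain ⟨r, hr, hsub⟩ := Metric.mem_nhds_iff.1
    (Filter.inter_mem hev (Filter.inter_mem (hD.mem_nhds hb) hball))
  refine ⟨r, hr, 1 / r ^ 2, by positivity, fun x hx => (hsub hx).2.1, fun x hx => ⟨?_, ?_⟩⟩
  · have h1 := (hsub hx).1
    simp only [mem_ofPred_eq, smul_eq_mul, hfix] at h1
    have h2 : H x - b = (H x - b - (x - b) * deriv H b) + (x - b) * deriv H b := by ring
    rw [h2]
    refine (norm_add_le _ _).trans ?_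
    rw [norm_mul]
    linarith
  · have hd : DifferentiableOn ℂ h (Metric.ball b r) :=
      (hH.mono fun x hx => (hsub hx).2.1).sub (by fun_prop)
    have h3 := Complex.dist_le_mul_div_pow_of_mapsTo_ball_of_isLittleO (n := 1) hd
      (fun x hx => (hsub hx).2.2) (by
        have e : (fun x => h x - h b) = fun x => H x - H b - (x - b) • deriv H b := by
          funext x; simp only [hh, smul_eq_mul]; ring
        rw [e]
        simp only [pow_one]
        exact hlo.norm_right) hx
    rw [dist_eq_norm, hhb, dist_eq_norm] at h3
    have e : H x - b - deriv H b * (x - b) = h x - b := by simp only [hh]; ring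
    rw [e]
    refine h3.trans (le_of_eq ?_)
    rw [div_pow]; ring

/-- The linearizing coordinate is the limit of `(H^[k] x - b) / l ^ k`, written as a telescoping
series. It converges geometrically because `H` contracts at a rate `s` with `s ^ 2 < ‖l‖` while
differing from its linear part by a quadratic error. -/
theorem exists_koenigs_function {D : Set ℂ} {H : ℂ → ℂ} {b : ℂ} (hD : IsOpen D)
    (hH : DifferentiableOn ℂ H D) (hb : IsAttractingFixedPt D H b) :
    ∃ r > 0, Metric.ball b r ⊆ D ∧ (∀ x ∈ Metric.ball b r, ‖H x - b‖ ≤ ‖x - b‖) ∧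
      ∃ φ : ℂ → ℂ, DifferentiableOn ℂ φ (Metric.ball b r) ∧ φ b = 0 ∧ HasDerivAt φ 1 b ∧
        ∀ x ∈ Metric.ball b r, φ (H x) = deriv H b * φ x := by
  obtain ⟨hbD, hfix, hl0, hl1⟩ := hb
  set l := deriv H b with hl
  have hlne : l ≠ 0 := norm_pos_iff.1 hl0
  -- a contraction rate `s` with `‖l‖ < s` and `s ^ 2 < ‖l‖`
  obtain ⟨s, hs1, hs2⟩ := exists_between (Real.lt_sqrt_of_sq_lt (show ‖l‖ ^ 2 < ‖l‖ by nlinarith))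
  have hs0 : 0 < s := hl0.trans hs1
  have hs3 : s ^ 2 < ‖l‖ := (Real.lt_sqrt hs0.le).1 hs2
  have hs4 : s < 1 := by nlinarith
  obtain ⟨r, hr, C, hC, hrD, hest⟩ := exists_quadratic_bound hD hH hbD hfix hs1
  have hle : ∀ x ∈ Metric.ball b r, ‖H x - b‖ ≤ ‖x - b‖ := fun x hx =>
    (hest x hx).1.trans (mul_le_of_le_one_left (norm_nonneg _) hs4.le)
  have hmaps : MapsTo H (Metric.ball b r) (Metric.ball b r) := fun x hx => by
    rw [mem_ball_iff_norm] at hx ⊢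
    exact (hle x (mem_ball_iff_norm.2 hx)).trans_lt hx
  have hiter : ∀ k : ℕ, ∀ x ∈ Metric.ball b r, ‖H^[k] x - b‖ ≤ s ^ k * ‖x - b‖ := by
    intro k
    induction k with
    | zero => intro x hx; simp
    | succ k ih =>
      intro x hx
      rw [Function.iterate_succ_apply']
      refine (hest _ (hmaps.iterate k hx)).1.trans ?_
      rw [pow_succ', mul_assoc]
      exact mul_le_mul_of_nonneg_left (ih x hx) hs0.le
  have hdiff : ∀ k : ℕ, DifferentiableOn ℂ H^[k] (Metric.ball b r) := by
    intro k
    induction k with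
    | zero => exact differentiableOn_id
    | succ k ih => exact ih.comp (hH.mono hrD) hmaps
  set a : ℕ → ℂ → ℂ := fun k x => (H^[k + 1] x - b) / l ^ (k + 1) - (H^[k] x - b) / l ^ k
    with ha
  set q := s ^ 2 / ‖l‖ with hq
  have hq0 : 0 < q := by positivity
  have hq1 : q < 1 := (div_lt_one hl0).2 hs3
  have habound : ∀ k, ∀ x ∈ Metric.ball b r, ‖a k x‖ ≤ C / ‖l‖ * q ^ k * ‖x - b‖ ^ 2 := by
    intro k x hx
    have e : a k x = (H (H^[k] x) - b - l * (H^[k] x - b)) / l ^ (k + 1) := by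
      simp only [ha]
      rw [Function.iterate_succ_apply']
      field_simp
      ring
    rw [e, norm_div, norm_pow, div_le_iff₀ (by positivity)]
    refine (hest _ (hmaps.iterate k hx)).2.trans ?_
    calc C * ‖H^[k] x - b‖ ^ 2 ≤ C * (s ^ k * ‖x - b‖) ^ 2 := by gcongr; exact hiter k x hx
      _ = _ := by rw [hq, div_pow]; field_simp; ring
  have hsum : Summable fun k => C / ‖l‖ * q ^ k * r ^ 2 :=
    ((summable_geometric_of_lt_one hq0.le hq1).mul_left _).mul_right _
  have habound' : ∀ k, ∀ x ∈ Metric.ball b r, ‖a k x‖ ≤ C / ‖l‖ * q ^ k * r ^ 2 := by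
    intro k x hx
    refine (habound k x hx).trans ?_
    have := (mem_ball_iff_norm.1 hx).le
    gcongr
  have had : ∀ k, DifferentiableOn ℂ (a k) (Metric.ball b r) := fun k =>
    (((hdiff (k + 1)).sub_const b).div_const _).sub (((hdiff k).sub_const b).div_const _)
  have hasum : ∀ x ∈ Metric.ball b r, Summable fun k => a k x := fun x hx =>
    Summable.of_norm_bounded hsum fun k => habound' k x hx
  set φ : ℂ → ℂ := fun x => x - b + ∑' k, a k x with hφ
  have hquad : ∀ x ∈ Metric.ball b r, ‖∑' k, a k x‖ ≤ (C / ‖l‖ * (1 - q)⁻¹) * ‖x - b‖ ^ 2 := by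
    intro x hx
    refine tsum_of_norm_bounded (g := fun k => C / ‖l‖ * q ^ k * ‖x - b‖ ^ 2) ?_
      fun k => habound k x hx
    exact ((hasSum_geometric_of_lt_one hq0.le hq1).mul_left _).mul_right _
  have hbB : b ∈ Metric.ball b r := Metric.mem_ball_self hr
  have hφb : φ b = 0 := by
    have := hquad b hbB
    simp only [sub_self, norm_zero, ne_eq, OfNat.ofNat_ne_zero, not_false_eq_true, zero_pow,
      mul_zero, norm_le_zero_iff] at this
    simp [hφ, this]
  refine ⟨r, hr, hrD, hle, φ, ?_, hφb, ?_, ?_⟩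
  · exact (differentiableOn_id.sub_const b).add
      (Complex.differentiableOn_tsum_of_summable_norm hsum had Metric.isOpen_ball habound')
  · have hO : (fun x => ∑' k, a k x) =O[𝓝 b] fun x => ‖x - b‖ ^ 2 := by
      refine Asymptotics.IsBigO.of_bound (C / ‖l‖ * (1 - q)⁻¹) ?_
      filter_upwards [Metric.ball_mem_nhds b hr] with x hx
      simpa using hquad x hx
    have h1 : HasDerivAt (fun x => ∑' k, a k x) 0 b :=
      (hO.hasFDerivAt (𝕜 := ℂ) one_lt_two).hasDerivAt
    have h2 := ((hasDerivAt_id b).sub_const b).add h1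
    rw [add_zero] at h2
    exact h2
  · intro x hx
    have e : ∀ k, a k (H x) = l * a (k + 1) x := by
      intro k
      simp only [ha]
      rw [← Function.iterate_succ_apply, ← Function.iterate_succ_apply]
      field_simp
      ring
    simp only [hφ]
    rw [(hasum x hx).tsum_eq_zero_add]
    simp only [e]
    rw [tsum_mul_left]
    have e0 : a 0 x = (H x - b) / l - (x - b) := by simp [ha]
    rw [e0]
    field_simp
    ring

/-- **Koenigs' theorem**: near an attracting fixed point `H` is conjugate to multiplication by its
multiplier. -/
theorem exists_linearization {D : Set ℂ} {H : ℂ → ℂ} {b : ℂ} (hD : IsOpen D)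
    (hH : DifferentiableOn ℂ H D) (hb : IsAttractingFixedPt D H b) :
    ∃ (φ ζ : ℂ → ℂ) (W : Set ℂ) (R : ℝ), 0 < R ∧ IsBiholomorphic φ ζ W (Metric.ball 0 R) ∧
      b ∈ W ∧ W ⊆ D ∧ φ b = 0 ∧ ∀ x ∈ W, H x ∈ W ∧ φ (H x) = deriv H b * φ x := by
  obtain ⟨r, hr, hrD, hle, φ, hφ, hφb, hφ1, hφH⟩ := exists_koenigs_function hD hH hb
  have han := hφ.analyticOnNhd Metric.isOpen_ball
  have hbB : b ∈ Metric.ball b r := Metric.mem_ball_self hr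
  have hstrict : HasStrictDerivAt φ 1 b := by
    have := (han b hbB).hasStrictDerivAt
    rwa [hφ1.deriv] at this
  set e := (hstrict.hasStrictFDerivAt_equiv one_ne_zero).toOpenPartialHomeomorph φ with he
  have hecoe : (e : ℂ → ℂ) = φ := HasStrictFDerivAt.toOpenPartialHomeomorph_coe _
  have hbe : b ∈ e.source := HasStrictFDerivAt.mem_toOpenPartialHomeomorph_source _
  have hd0 : ∀ᶠ x in 𝓝 b, deriv φ x ≠ 0 := by
    have : ContinuousAt (deriv φ) b := (han.deriv b hbB).continuousAt
    exact this.eventually_ne (by rw [hφ1.deriv]; exact one_ne_zero)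
  obtain ⟨ρ, hρ, hρsub⟩ := Metric.mem_nhds_iff.1 (Filter.inter_mem hd0
    (Filter.inter_mem (e.open_source.mem_nhds hbe) (Metric.ball_mem_nhds b hr)))
  -- restrict the local inverse to a disc that it maps into `ball b ρ`
  have heb : e b = 0 := by rw [hecoe, hφb]
  have h0t : (0 : ℂ) ∈ e.target := heb ▸ e.map_source hbe
  have hs0 : e.symm 0 = b := by rw [← heb]; exact e.left_inv hbe
  obtain ⟨R, hR, hRsub⟩ := Metric.mem_nhds_iff.1 (Filter.inter_mem (e.open_target.mem_nhds h0t)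
    ((e.continuousAt_symm h0t).preimage_mem_nhds (by
      rw [hs0]; exact Metric.ball_mem_nhds b hρ)))
  have hWopen : IsOpen (Metric.ball b ρ ∩ φ ⁻¹' Metric.ball 0 R) :=
    (hφ.continuousOn.mono fun x hx => (hρsub hx).2.2).isOpen_inter_preimage
      Metric.isOpen_ball Metric.isOpen_ball
  refine ⟨φ, e.symm, Metric.ball b ρ ∩ φ ⁻¹' Metric.ball 0 R, R, hR,
    ⟨hWopen, Metric.isOpen_ball, hφ.mono fun x hx => (hρsub hx.1).2.2, ?_, fun x hx => hx.2, ?_,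
      ?_, ?_⟩, ⟨Metric.mem_ball_self hρ, ?_⟩, fun x hx => hrD (hρsub hx.1).2.2, hφb, ?_⟩
  · intro z hz
    have hz' := hRsub hz
    have hzs := hρsub hz'.2
    have hd : HasDerivAt e (deriv φ (e.symm z)) (e.symm z) := by
      rw [hecoe]
      exact (hφ.differentiableAt (Metric.isOpen_ball.mem_nhds hzs.2.2)).hasDerivAt
    exact (e.hasDerivAt_symm hz'.1 hzs.1 hd).differentiableAt.differentiableWithinAt
  · intro z hz
    refine ⟨(hRsub hz).2, ?_⟩
    rw [mem_preimage, ← hecoe, e.right_inv (hRsub hz).1]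
    exact hz
  · intro x hx
    rw [← hecoe]; exact e.left_inv (hρsub hx.1).2.1
  · intro z hz
    rw [← hecoe]; exact e.right_inv (hRsub hz).1
  · rw [mem_preimage, hφb]; exact Metric.mem_ball_self hR
  · intro x hx
    have hxr := (hρsub hx.1).2.2
    have hxH := hφH x hxr
    refine ⟨⟨?_, ?_⟩, hxH⟩
    · have := hx.1
      rw [mem_ball_iff_norm] at this ⊢
      exact (hle x hxr).trans_lt this
    · have h1 : ‖φ x‖ < R := mem_ball_zero_iff.1 hx.2
      rw [mem_preimage, hxH, mem_ball_zero_iff, norm_mul]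
      exact (mul_le_of_le_one_left (norm_nonneg _) hb.2.2.2.le).trans_lt h1

/-! ### Small symmetries near an attracting fixed point force laminarity -/

/-- Near an attracting fixed point, `K` looks like a set `X` invariant under `z ↦ l * z`. -/
theorem exists_linear_model {K D : Set ℂ} {H : ℂ → ℂ} {b : ℂ} (hK : IsClosed K)
    (hH : IsSymmetry K D H) (hb : IsAttractingFixedPt D H b) :
    ∃ (φ ζ : ℂ → ℂ) (W : Set ℂ) (R : ℝ) (l : ℂ) (X : Set ℂ), 0 < R ∧
      IsBiholomorphic φ ζ W (Metric.ball 0 R) ∧ b ∈ W ∧ φ b = 0 ∧ l ≠ 0 ∧ ‖l‖ < 1 ∧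
      (∀ x ∈ W, x ∈ K ↔ φ x ∈ X) ∧ (∀ z ∈ Metric.ball (0 : ℂ) R, z ∈ X ↔ l * z ∈ X) ∧
      closure X ∩ Metric.ball 0 R ⊆ X := by
  obtain ⟨φ, ζ, W, R, hR, hbi, hbW, hWD, hφb, hφH⟩ :=
    exists_linearization hH.domain.1 hH.holo hb
  have hX : ∀ z ∈ Metric.ball (0 : ℂ) R, (z ∈ Metric.ball (0 : ℂ) R ∩ ζ ⁻¹' K ↔ ζ z ∈ K) :=
    fun z hz => ⟨fun h => h.2, fun h => ⟨hz, h⟩⟩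
  refine ⟨φ, ζ, W, R, deriv H b, Metric.ball 0 R ∩ ζ ⁻¹' K, hR, hbi, hbW, hφb,
    norm_pos_iff.1 hb.2.2.1, hb.2.2.2, ?_, ?_, ?_⟩
  · intro x hx
    rw [hX _ (hbi.mapsTo hx), hbi.left_inv x hx]
  · intro z hz
    have hζ := hbi.mapsTo_inv hz
    obtain ⟨h1, h2⟩ := hφH _ hζ
    rw [hbi.right_inv z hz] at h2
    have h3 : ζ (deriv H b * z) = H (ζ z) := by rw [← h2, hbi.left_inv _ h1]
    have h4 : deriv H b * z ∈ Metric.ball (0 : ℂ) R := h2 ▸ hbi.mapsTo h1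
    rw [hX z hz, hX _ h4, h3]
    have h5 := hH.mem_iff _ (hWD hζ)
    exact ⟨fun h => (h5.1 ⟨hWD hζ, h⟩).2, fun h => (h5.2 ⟨mem_image_of_mem H (hWD hζ), h⟩).2⟩
  · rintro z ⟨hz, hzB⟩
    refine ⟨hzB, ?_⟩
    have hc : ContinuousAt ζ z :=
      hbi.holo_inv.continuousOn.continuousAt (Metric.isOpen_ball.mem_nhds hzB)
    exact hK.mem_of_frequently_of_tendsto
      ((mem_closure_iff_frequently.1 hz).mono fun w hw => hw.2) hc

/-- Arbitrarily small symmetries that move the attracting point `b` make `K` laminar near `b`. -/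
theorem exists_isLaminarRel_of_moving {K : Set ℂ} {b : ℂ} (hK : IsClosed K) (hbK : b ∈ K)
    (hb : b ∈ attractingPts K) {r : ℝ} (hr : 0 < r)
    (hsm : ∀ ε > 0, ∃ g, SmallSym K b r ε g ∧ g b ≠ b) : ∃ U, IsLaminarRel K U := by
  obtain ⟨D, H, hH, hbD⟩ := hb
  obtain ⟨φ, ζ, W, R, l, X, hR, hbi, hbW, hφb, hl0, hl1, hKX, hX, hcl⟩ :=
    exists_linear_model hK hH hbD
  obtain ⟨r', hr', hr'R, -, hconj⟩ := hbi.exists_conj_smallSym hKX hbW hr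
  rw [hφb] at hr'R hconj
  have hsm' : ∀ ε > 0, ∃ g, SmallSym X 0 r' ε g ∧ g 0 ≠ 0 := by
    intro ε hε
    obtain ⟨ε', hε', hg'⟩ := hconj ε hε
    obtain ⟨g, hg, hgb⟩ := hsm ε' hε'
    obtain ⟨h1, h2⟩ := hg' g hg
    refine ⟨_, h1, fun h0 => hgb ?_⟩
    have hζ0 : ζ 0 = b := by rw [← hφb, hbi.left_inv b hbW]
    have h3 := h2 0 (Metric.mem_ball_self hr')
    rw [hζ0] at h3
    have h4 : φ (g b) = 0 := by simpa [hζ0] using h0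
    rw [← hbi.left_inv _ h3, h4, hζ0]
  obtain ⟨d, hd, hflow⟩ := exists_translation_flow hl0 hl1 hr' (fun z hz => hX z (hr'R hz))
    (fun z hz => hcl ⟨hz.1, hr'R hz.2⟩) hsm'
  have hsub : Metric.ball (0 : ℂ) (r' / 8) ⊆ Metric.ball 0 R :=
    (Metric.ball_subset_ball (by linarith)).trans hr'R
  refine ⟨_, isLaminarRel_of_flow (hbi.restrict Metric.isOpen_ball hsub) hK
    ⟨b, ⟨hbW, ?_⟩, hbK⟩ hd ?_⟩
  · rw [mem_preimage, hφb]; exact Metric.mem_ball_self (by linarith)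
  · intro z hz hzK t ht hzt
    have e : ∀ w ∈ Metric.ball (0 : ℂ) (r' / 8), ζ w ∈ K ↔ w ∈ X := fun w hw => by
      rw [hKX _ (hbi.mapsTo_inv (hsub hw)), hbi.right_inv _ (hsub hw)]
    rw [e _ hzt]
    exact hflow z hz ((e z hz).1 hzK) t ht

/-- Arbitrarily small nontrivial symmetries near an attracting point make `K` laminar somewhere,
provided that attracting points accumulate there. When the symmetries fix `b`, the role of `b` is
taken over by an attracting point nearby. -/
theorem exists_isLaminarRel {K : Set ℂ} {b : ℂ} (hK : IsClosed K) (hbK : b ∈ K)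
    (hb : b ∈ attractingPts K) (hacc : AccPt b (Filter.principal (attractingPts K ∩ K)))
    {r : ℝ} (hr : 0 < r)
    (hsm : ∀ ε > 0, ∃ g, SmallSym K b r ε g ∧ ∃ z ∈ Metric.ball b r, g z ≠ z) :
    ∃ U, IsLaminarRel K U := by
  by_cases hmove : ∀ ε > 0, ∃ g, SmallSym K b r ε g ∧ g b ≠ b
  · exact exists_isLaminarRel_of_moving hK hbK hb hr hmove
  push Not at hmove
  obtain ⟨ε₀, hε₀, hfix⟩ := hmove
  obtain ⟨D, H, hH, hbD⟩ := hb
  obtain ⟨φ, ζ, W, R, l, X, hR, hbi, hbW, hφb, hl0, hl1, hKX, hX, hcl⟩ :=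
    exists_linear_model hK hH hbD
  obtain ⟨r', hr', hr'R, hζr, hconj⟩ := hbi.exists_conj_smallSym hKX hbW hr
  rw [hφb] at hr'R hconj hζr
  have hζ0 : ζ 0 = b := by rw [← hφb, hbi.left_inv b hbW]
  have hsub2 : Metric.ball (0 : ℂ) (r' / 2) ⊆ Metric.ball 0 r' :=
    Metric.ball_subset_ball (by linarith)
  -- small symmetries of the linear model whose only fixed point is the origin
  have hsm' : ∀ ε > 0, ∃ G, SmallSym X 0 (r' / 2) ε G ∧
      ∀ z ∈ Metric.ball (0 : ℂ) r', z ≠ 0 → G z ≠ z := by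
    intro ε hε
    obtain ⟨ε', hε', hg'⟩ := hconj (min (ε / 3) (r' / 4)) (by positivity)
    obtain ⟨g, hg, z₁, hz₁, hgz₁⟩ := hsm (min ε' ε₀) (by positivity)
    obtain ⟨h1, h2⟩ := hg' g (hg.mono subset_rfl (min_le_left _ _))
    have hgb : g b = b := hfix g (hg.mono subset_rfl (min_le_right _ _))
    obtain ⟨G, hG, hGne⟩ := h1.exists_forall_ne hl0 hl1 hr' (min_le_right _ _)
      (fun z hz => hX z (hr'R hz)) (by simp [hζ0, hgb, hφb]) (by
        by_contra hid
        push Not at hid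
        have hev : g =ᶠ[𝓝 b] id := by
          have hc : ContinuousAt φ b :=
            hbi.holo.continuousOn.continuousAt (hbi.open_source.mem_nhds hbW)
          have hn : φ ⁻¹' Metric.ball 0 r' ∈ 𝓝 b := hc.preimage_mem_nhds (by
            rw [hφb]; exact Metric.ball_mem_nhds _ hr')
          filter_upwards [hn, hbi.open_source.mem_nhds hbW] with x hx hxW
          have h3 := hid (φ x) hx
          have h4 := h2 (φ x) hx
          simp only [Function.comp_apply] at h3
          rw [hbi.left_inv x hxW] at h3 h4
          rw [← hbi.left_inv _ h4, h3, hbi.left_inv x hxW]; rfl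
        exact hgz₁ ((hg.holo.analyticOnNhd Metric.isOpen_ball).eqOn_of_preconnected_of_eventuallyEq
          analyticOnNhd_id (convex_ball _ _).isPreconnected (Metric.mem_ball_self hr) hev hz₁))
    exact ⟨G, hG.mono subset_rfl (by linarith [min_le_left (ε / 3) (r' / 4)]), hGne⟩
  -- move to a nearby attracting point
  have hnhds : W ∩ φ ⁻¹' Metric.ball 0 (r' / 2) ∈ 𝓝 b :=
    (hbi.holo.continuousOn.isOpen_inter_preimage hbi.open_source Metric.isOpen_ball).mem_nhds
      ⟨hbW, by rw [mem_preimage, hφb]; exact Metric.mem_ball_self (by linarith)⟩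
  obtain ⟨b', ⟨⟨hb'W, hb'B⟩, hb'a, hb'K⟩, hb'b⟩ := accPt_iff_nhds.1 hacc _ hnhds
  have hφb' : φ b' ≠ 0 := fun h0 => hb'b (by rw [← hbi.left_inv b' hb'W, h0, hζ0])
  obtain ⟨r₂, hr₂, hr₂sub⟩ := Metric.mem_nhds_iff.1 (Metric.isOpen_ball.mem_nhds hb'B)
  obtain ⟨r₃, hr₃, -, -, hconj'⟩ := hbi.symm.exists_conj_smallSym (K := X) (X := K)
    (fun z hz => by rw [hKX _ (hbi.mapsTo_inv hz), hbi.right_inv z hz])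
    (hr'R (hsub2 hb'B)) hr₂
  rw [hbi.left_inv b' hb'W] at hconj'
  refine exists_isLaminarRel_of_moving hK hb'K hb'a hr₃ fun ε hε => ?_
  obtain ⟨ε', hε', hG'⟩ := hconj' ε hε
  obtain ⟨G, hG, hGne⟩ := hsm' ε' hε'
  obtain ⟨h1, h2⟩ := hG' G (hG.mono hr₂sub le_rfl)
  refine ⟨_, h1, fun h0 => hGne _ (hsub2 hb'B) hφb' ?_⟩
  have h3 := h2 b' (Metric.mem_ball_self hr₃)
  rw [← hbi.right_inv _ h3]
  exact congrArg φ h0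

/-! ### Compactness of the conformal self-maps -/

/-- `f` represents an element of `conformalSelfMaps V K`. -/
structure IsConformalSelfMap (V K : Set ℂ) (f : ℂ → ℂ) : Prop where
  conformal : IsConformalOn f V
  injOn : InjOn f V
  image_eq : f '' K = K

theorem IsConformalSelfMap.mem_iff {V K : Set ℂ} {f : ℂ → ℂ} (hf : IsConformalSelfMap V K f)
    (hKV : K ⊆ V) {x : ℂ} (hx : x ∈ V) : x ∈ K ↔ f x ∈ K := by
  constructor
  · intro h; rw [← hf.image_eq]; exact mem_image_of_mem f h
  · intro h
    rw [← hf.image_eq] at h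
    obtain ⟨y, hy, hyx⟩ := h
    rwa [← hf.injOn (hKV hy) hx hyx]

theorem IsConformalSelfMap.differentiableOn_ball {V K : Set ℂ} {f : ℂ → ℂ}
    (hf : IsConformalSelfMap V K f) {a : ℂ} {s : ℝ} (hs : 0 < s) (hV : Metric.ball a s ⊆ V) :
    DifferentiableOn ℂ f (Metric.ball a s) ∨
      DifferentiableOn ℂ (fun z => conj (f z)) (Metric.ball a s) := by
  have haB : a ∈ Metric.ball a s := Metric.mem_ball_self hs
  have hsub := (convex_ball a s).isPreconnected.subset_connectedComponentIn haB hV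
  exact (hf.conformal a (hV haB)).2.imp (fun h => h.mono hsub) fun h => h.mono hsub

/-- Only finitely many components of `V` occur, so infinitely many self-maps give infinitely many
restrictions to one of them, of which infinitely many are of the same type (holomorphic or
antiholomorphic). -/
theorem exists_seq_of_infinite {V K : Set ℂ} (hK : IsCompact K) (hV : IsOpen V) (hKV : K ⊆ V)
    (hcomp : ∀ x ∈ V, (connectedComponentIn V x ∩ K).Nonempty)
    (hinf : (conformalSelfMaps V K).Infinite) :
    ∃ x₀ ∈ K, ∃ f : ℕ → ℂ → ℂ, (∀ n, IsConformalSelfMap V K (f n)) ∧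
      (∀ m n, m ≠ n → ¬ EqOn (f m) (f n) (connectedComponentIn V x₀)) ∧
      ((∀ n, DifferentiableOn ℂ (f n) (connectedComponentIn V x₀)) ∨
        ∀ n, DifferentiableOn ℂ (fun z => conj (f n z)) (connectedComponentIn V x₀)) := by
  classical
  obtain ⟨t, htK, htcov⟩ := hK.elim_nhds_subcover (fun x => connectedComponentIn V x)
    fun x hx => hV.connectedComponentIn.mem_nhds (mem_connectedComponentIn (hKV hx))
  have hext : ∀ g : conformalSelfMaps V K, ∃ f : ℂ → ℂ, (fun x : V => f x) = g ∧
      IsConformalSelfMap V K f := fun g => by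
    obtain ⟨f, h1, h2, h3, h4⟩ := g.2
    exact ⟨f, h1, h2, h3, h4⟩
  choose E hE hEm using hext
  -- the restriction to the component of `x`, extended by zero
  let T : ℂ → conformalSelfMaps V K → (ℂ → ℂ) := fun x g =>
    (connectedComponentIn V x).indicator (E g)
  have hT : ∀ x g g', T x g = T x g' ↔ EqOn (E g) (E g') (connectedComponentIn V x) := by
    intro x g g'
    constructor
    · intro h y hy
      have := congrFun h y
      simpa only [T, indicator_of_mem hy] using this
    · intro h
      exact indicator_congr h
  have hex : ∃ x ∈ t, (range (T x)).Infinite := by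
    by_contra hcon
    push Not at hcon
    have hfin : ∀ x : t, Finite (range (T x)) := fun x => (hcon x x.2)
    have hinj : Function.Injective
        (fun (g : conformalSelfMaps V K) (x : t) => (⟨T x g, mem_range_self g⟩ : range (T x))) := by
      intro g g' hgg
      apply Subtype.ext
      rw [← hE g, ← hE g']
      funext x
      obtain ⟨y, hyx, hyK⟩ := hcomp x x.2
      obtain ⟨x₁, hx₁, hy⟩ := mem_iUnion₂.1 (htcov hyK)
      have e : connectedComponentIn V (x : ℂ) = connectedComponentIn V x₁ :=
        (connectedComponentIn_eq hyx).trans (connectedComponentIn_eq hy).symm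
      have h1 : T x₁ g = T x₁ g' := congrArg Subtype.val (congrFun hgg ⟨x₁, hx₁⟩)
      exact (hT _ _ _).1 h1 (e ▸ mem_connectedComponentIn x.2)
    exact hinf (Finite.of_injective _ hinj)
  obtain ⟨x₀, hx₀, hinf₀⟩ := hex
  have hx₀K := htK x₀ hx₀
  set C := connectedComponentIn V x₀ with hC
  set S₁ : Set (conformalSelfMaps V K) := {g | DifferentiableOn ℂ (E g) C} with hS₁
  set S₂ : Set (conformalSelfMaps V K) := {g | DifferentiableOn ℂ (fun z => conj (E g z)) C}
    with hS₂
  have hunion : S₁ ∪ S₂ = univ := eq_univ_of_forall fun g =>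
    ((hEm g).conformal x₀ (hKV hx₀K)).2
  have hseq : ∀ S : Set (conformalSelfMaps V K), (T x₀ '' S).Infinite →
      ∃ g : ℕ → conformalSelfMaps V K, (∀ n, g n ∈ S) ∧
        ∀ m n, m ≠ n → ¬ EqOn (E (g m)) (E (g n)) C := by
    intro S hS
    have hmem := fun n => (hS.natEmbedding _ n).2
    choose g hgS hg using hmem
    refine ⟨g, hgS, fun m n hmn heq => hmn ?_⟩
    have := (hT x₀ _ _).2 heq
    rw [hg, hg] at this
    exact (hS.natEmbedding _).injective (Subtype.ext this)
  rw [← image_univ, ← hunion, image_union, infinite_union] at hinf₀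
  rcases hinf₀ with h | h
  · obtain ⟨g, hg, hne⟩ := hseq _ h
    exact ⟨x₀, hx₀K, fun n => E (g n), fun n => hEm _, hne, Or.inl hg⟩
  · obtain ⟨g, hg, hne⟩ := hseq _ h
    exact ⟨x₀, hx₀K, fun n => E (g n), fun n => hEm _, hne, Or.inr hg⟩

/-- The distortion estimate for self-maps; composing with the conjugation covers the
antiholomorphic case. -/
theorem IsConformalSelfMap.norm_sub_le {V K : Set ℂ} {f : ℂ → ℂ}
    (hf : IsConformalSelfMap V K f) {a x : ℂ} {s : ℝ} (hs : 0 < s) (hV : Metric.ball a s ⊆ V)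
    (hx : x ∈ V) (hxs : x ∉ Metric.ball a s) {z : ℂ} (hz : dist z a ≤ s / 20) :
    ‖f z - f a‖ ≤ 17 * ‖f x - f a‖ := by
  have hom : f x ∉ f '' Metric.ball a s := by
    rintro ⟨y, hy, hyx⟩
    exact hxs (hf.injOn (hV hy) hx hyx ▸ hy)
  rcases hf.differentiableOn_ball hs hV with h | h
  · exact norm_sub_le_of_omits h (hf.injOn.mono hV) hom hz
  · have := norm_sub_le_of_omits (f := fun z => conj (f z)) (w := conj (f x)) h
      (fun y hy y' hy' he => hf.injOn (hV hy) (hV hy') (star_injective he))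
      (by rintro ⟨y, hy, hyx⟩; exact hom ⟨y, hy, star_injective hyx⟩) hz
    simpa only [← map_sub, Complex.norm_conj] using this

/-- All self-maps are uniformly bounded on a disc about any point `a` of `K`: a second point of `K`
provides an omitted value. -/
theorem exists_uniform_bound {V K : Set ℂ} (hK : IsCompact K)
    (hV : IsOpen V) (hKV : K ⊆ V) {a : ℂ} (ha : a ∈ K) (hacc : AccPt a (Filter.principal K)) :
    ∃ s > 0, ∃ M > 0, Metric.ball a s ⊆ V ∧ ∀ f, IsConformalSelfMap V K f →
      ∀ z ∈ Metric.ball a s, ‖f z‖ ≤ M := by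
  obtain ⟨ρ, hρ, hρV⟩ := Metric.mem_nhds_iff.1 (hV.mem_nhds (hKV ha))
  obtain ⟨x, ⟨hxρ, hxK⟩, hxa⟩ := accPt_iff_nhds.1 hacc _ (Metric.ball_mem_nhds a hρ)
  obtain ⟨C, hC, hKC⟩ := hK.isBounded.exists_pos_norm_le
  have hs : 0 < dist x a := dist_pos.2 hxa
  have hsV : Metric.ball a (dist x a) ⊆ V :=
    (Metric.ball_subset_ball (Metric.mem_ball.1 hxρ).le).trans hρV
  refine ⟨dist x a / 20, by positivity, 35 * C, by positivity,
    (Metric.ball_subset_ball (by linarith)).trans hsV, fun f hf z hz => ?_⟩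
  have h1 := hf.norm_sub_le hs hsV (hKV hxK) (by simp) (Metric.mem_ball.1 hz).le
  have h2 := hKC _ ((hf.mem_iff hKV (hKV ha)).1 ha)
  have h3 := hKC _ ((hf.mem_iff hKV (hKV hxK)).1 hxK)
  have h4 := norm_le_norm_add_norm_sub' (f z) (f a)
  have h5 := _root_.norm_sub_le (f x) (f a)
  linarith

theorem dist_le_of_bounded {f : ℂ → ℂ} {y z : ℂ} {r M : ℝ}
    (hf : DifferentiableOn ℂ f (Metric.ball y r)) (hM : ∀ w ∈ Metric.ball y r, ‖f w‖ ≤ M)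
    (hz : z ∈ Metric.ball y r) : dist (f z) (f y) ≤ 2 * M / r * dist z y := by
  refine Complex.dist_le_div_mul_dist_of_mapsTo_ball hf (fun w hw => ?_) hz
  have hr : 0 < r := dist_nonneg.trans_lt (Metric.mem_ball.1 hz)
  rw [mem_closedBall_iff_norm]
  have h1 := hM w hw
  have h2 := hM y (Metric.mem_ball_self hr)
  exact (norm_sub_le _ _).trans (by linarith)

theorem IsConformalSelfMap.dist_le {V K : Set ℂ} {f : ℂ → ℂ} (hf : IsConformalSelfMap V K f)
    {y z : ℂ} {r M : ℝ} (hV : Metric.ball y r ⊆ V) (hM : ∀ w ∈ Metric.ball y r, ‖f w‖ ≤ M)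
    (hz : z ∈ Metric.ball y r) : dist (f z) (f y) ≤ 2 * M / r * dist z y := by
  have hr : 0 < r := dist_nonneg.trans_lt (Metric.mem_ball.1 hz)
  rcases hf.differentiableOn_ball hr hV with h | h
  · exact dist_le_of_bounded h hM hz
  · have := dist_le_of_bounded h (fun w hw => by simpa using hM w hw) hz
    rwa [Complex.dist_conj_conj] at this

/-- **Montel's theorem** for conformal self-maps: every sequence has a subsequence that converges
uniformly near each point of `K`. -/
theorem exists_subseq_tendstoUniformlyOn {V K : Set ℂ} (hK : IsCompact K)
    (hacc : ∀ x ∈ K, AccPt x (Filter.principal K)) (hV : IsOpen V) (hKV : K ⊆ V)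
    {f : ℕ → ℂ → ℂ} (hf : ∀ n, IsConformalSelfMap V K (f n)) :
    ∃ (u : ℕ → ℕ) (F : ℂ → ℂ), StrictMono u ∧ ∀ a ∈ K, ∃ s > 0, Metric.ball a s ⊆ V ∧
      TendstoUniformlyOn (fun n => f (u n)) F Filter.atTop (Metric.ball a s) := by
  classical
  have hbd := fun a (ha : a ∈ K) => exists_uniform_bound hK hV hKV ha (hacc a ha)
  choose! s hs M hM hsV hsM using hbd
  obtain ⟨t, htK, htcov⟩ := hK.elim_nhds_subcover (fun a => Metric.ball a (s a / 4))
    fun a ha => Metric.ball_mem_nhds a (by have := hs a ha; linarith)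
  set Y : Set ℂ := ⋃ a ∈ t, Metric.closedBall a (s a / 4) with hY
  have hYc : IsCompact Y := t.isCompact_biUnion fun a _ => isCompact_closedBall _ _
  have hYball : ∀ y ∈ Y, ∃ a ∈ t, Metric.ball y (s a / 2) ⊆ Metric.ball a (s a) := by
    intro y hy
    obtain ⟨a, ha, hya⟩ := mem_iUnion₂.1 hy
    refine ⟨a, ha, fun z hz => ?_⟩
    rw [Metric.mem_closedBall] at hya
    rw [Metric.mem_ball] at hz ⊢
    have := hs a (htK a ha)
    linarith [dist_triangle z y a]
  have hlip : ∀ y ∈ Y, ∃ r > 0, ∃ L, ∀ n, ∀ z ∈ Metric.ball y r,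
      dist (f n z) (f n y) ≤ L * dist z y := by
    intro y hy
    obtain ⟨a, ha, hsub⟩ := hYball y hy
    have haK := htK a ha
    refine ⟨s a / 2, half_pos (hs a haK), 2 * M a / (s a / 2), fun n z hz => ?_⟩
    exact (hf n).dist_le (hsub.trans (hsV a haK))
      (fun w hw => hsM a haK _ (hf n) w (hsub hw)) hz
  have : CompactSpace Y := isCompact_iff_compactSpace.1 hYc
  have hcont : ∀ n, Continuous fun y : Y => f n y := by
    intro n
    rw [continuous_iff_continuousAt]
    intro y
    obtain ⟨r, hr, L, hL⟩ := hlip y y.2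
    refine ContinuousAt.comp (g := f n) (f := Subtype.val) ?_ continuousAt_subtype_val
    exact continuousAt_of_locally_lipschitz hr L fun z hz => hL n z hz
  set Φ : ℕ → BoundedContinuousFunction Y ℂ :=
    fun n => BoundedContinuousFunction.mkOfCompact ⟨fun y : Y => f n y, hcont n⟩ with hΦ
  obtain ⟨B, hB⟩ : ∃ B, ∀ n, ∀ y ∈ Y, ‖f n y‖ ≤ B := by
    refine ⟨∑ a ∈ t, M a, fun n y hy => ?_⟩
    obtain ⟨a, ha, hya⟩ := hYball y hy
    have hsa := hs a (htK a ha)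
    refine (hsM a (htK a ha) _ (hf n) y (hya (Metric.mem_ball_self (by linarith)))).trans ?_
    exact Finset.single_le_sum (f := M) (fun b hb => (hM b (htK b hb)).le) ha
  have hcomp := BoundedContinuousFunction.arzela_ascoli (Metric.closedBall (0 : ℂ) B)
    (isCompact_closedBall _ _) (range Φ) (by
      rintro _ y ⟨n, rfl⟩
      exact mem_closedBall_zero_iff.2 (hB n y y.2)) (by
      intro y
      obtain ⟨r, hr, L, hL⟩ := hlip y y.2
      refine Metric.equicontinuousAt_of_continuity_modulus (fun z => L * dist z y) ?_ _ ?_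
      · have : Filter.Tendsto (fun z : Y => L * dist z y) (𝓝 y) (𝓝 (L * dist y y)) :=
          Continuous.tendsto (by fun_prop) y
        simpa using this
      · filter_upwards [Metric.ball_mem_nhds y hr] with z hz
        rintro ⟨_, n, rfl⟩
        rw [dist_comm]
        exact hL n z hz)
  obtain ⟨F, -, u, hu, hlim⟩ := hcomp.tendsto_subseq (fun n => subset_closure (mem_range_self n))
  refine ⟨u, fun z => if h : z ∈ Y then F ⟨z, h⟩ else 0, hu, fun a ha => ?_⟩
  obtain ⟨a', ha', haa'⟩ := mem_iUnion₂.1 (htcov ha)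
  obtain ⟨r, hr, hrsub⟩ := Metric.mem_nhds_iff.1 (Metric.isOpen_ball.mem_nhds haa')
  refine ⟨r, hr, hrsub.trans ((Metric.ball_subset_ball ?_).trans (hsV a' (htK a' ha'))), ?_⟩
  · have := hs a' (htK a' ha'); linarith
  rw [Metric.tendstoUniformlyOn_iff]
  intro ε hε
  rw [BoundedContinuousFunction.tendsto_iff_tendstoUniformly, Metric.tendstoUniformly_iff] at hlim
  filter_upwards [hlim ε hε] with n hn z hz
  have hzY : z ∈ Y := mem_iUnion₂.2 ⟨a', ha', Metric.ball_subset_closedBall (hrsub hz)⟩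
  rw [dif_pos hzY]
  exact hn ⟨z, hzY⟩

/-! ### Limits of conformal self-maps are nowhere locally constant on `K` -/

theorem differentiableOn_of_frequently {G : ℕ → ℂ → ℂ} {F : ℂ → ℂ} {U : Set ℂ} (hU : IsOpen U)
    (hlim : TendstoUniformlyOn G F Filter.atTop U)
    (hG : ∃ᶠ n in Filter.atTop, DifferentiableOn ℂ (G n) U) : DifferentiableOn ℂ F U := by
  -- pass to the filter of those indices for which the function is holomorphic
  have hne : (Filter.atTop ⊓ Filter.principal {n | DifferentiableOn ℂ (G n) U}).NeBot :=
    Filter.frequently_iff_neBot.1 hG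
  have hlim' : TendstoUniformlyOn G F
      (Filter.atTop ⊓ Filter.principal {n | DifferentiableOn ℂ (G n) U}) U :=
    fun u hu => (hlim u hu).filter_mono inf_le_left
  exact hlim'.tendstoLocallyUniformlyOn.differentiableOn
    (Filter.eventually_inf_principal.2 (Filter.Eventually.of_forall fun n hn => hn)) hU

/-- A uniform limit of conformal maps on a disc is holomorphic or antiholomorphic; `σ` is the
identity or the conjugation. -/
theorem exists_isometry_differentiableOn {V K : Set ℂ} {f : ℕ → ℂ → ℂ} {F : ℂ → ℂ}
    (hf : ∀ n, IsConformalSelfMap V K (f n)) {a : ℂ} {s : ℝ} (hs : 0 < s)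
    (hV : Metric.ball a s ⊆ V) (hlim : TendstoUniformlyOn f F Filter.atTop (Metric.ball a s)) :
    ∃ σ : ℂ → ℂ, Isometry σ ∧ DifferentiableOn ℂ (fun z => σ (F z)) (Metric.ball a s) ∧
      ∃ᶠ n in Filter.atTop, DifferentiableOn ℂ (fun z => σ (f n z)) (Metric.ball a s) := by
  have h : ∃ᶠ n in Filter.atTop, DifferentiableOn ℂ (f n) (Metric.ball a s) ∨
      DifferentiableOn ℂ (fun z => conj (f n z)) (Metric.ball a s) :=
    (Filter.Eventually.of_forall fun n => (hf n).differentiableOn_ball hs hV).frequently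
  rcases Filter.frequently_or_distrib.1 h with h | h
  · exact ⟨id, isometry_id, differentiableOn_of_frequently Metric.isOpen_ball hlim h, h⟩
  · have hc : Isometry (fun z : ℂ => conj z) := Complex.isometry_conj
    refine ⟨_, hc, ?_, h⟩
    exact differentiableOn_of_frequently Metric.isOpen_ball
      (hc.uniformContinuous.comp_tendstoUniformlyOn hlim) h

theorem eqOn_const_of_eventually_eq {F σ : ℂ → ℂ} (hσ : Isometry σ) {a b : ℂ} {s : ℝ}
    (hF : DifferentiableOn ℂ (fun z => σ (F z)) (Metric.ball a s)) (hb : b ∈ Metric.ball a s)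
    (hconst : ∀ᶠ z in 𝓝 b, F z = F b) : ∀ z ∈ Metric.ball a s, F z = F b := by
  intro z hz
  have hev : (fun z => σ (F z)) =ᶠ[𝓝 b] fun _ => σ (F b) := by
    filter_upwards [hconst] with w hw
    rw [hw]
  exact hσ.injective ((hF.analyticOnNhd Metric.isOpen_ball).eqOn_of_preconnected_of_eventuallyEq
    analyticOnNhd_const (convex_ball _ _).isPreconnected hb hev hz)

/-- The `f n` are conformal self-maps of `(V, K)` that converge to `F` uniformly on some disc about
each point of `K`. -/
structure ConvergesNear (V K : Set ℂ) (f : ℕ → ℂ → ℂ) (F : ℂ → ℂ) : Prop where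
  selfMap : ∀ n, IsConformalSelfMap V K (f n)
  tendsto : ∀ a ∈ K, ∃ s > 0, Metric.ball a s ⊆ V ∧
    TendstoUniformlyOn f F Filter.atTop (Metric.ball a s)

theorem ConvergesNear.tendsto_apply {V K : Set ℂ} {f : ℕ → ℂ → ℂ} {F : ℂ → ℂ}
    (h : ConvergesNear V K f F) {a : ℂ} (ha : a ∈ K) :
    Filter.Tendsto (fun n => f n a) Filter.atTop (𝓝 (F a)) := by
  obtain ⟨s, hs, -, hlim⟩ := h.tendsto a ha
  exact hlim.tendsto_at (Metric.mem_ball_self hs)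

theorem ConvergesNear.continuousAt {V K : Set ℂ} {f : ℕ → ℂ → ℂ} {F : ℂ → ℂ}
    (h : ConvergesNear V K f F) {a : ℂ} (ha : a ∈ K) : ContinuousAt F a := by
  obtain ⟨s, hs, hV, hlim⟩ := h.tendsto a ha
  obtain ⟨σ, hσ, hd, -⟩ := exists_isometry_differentiableOn h.selfMap hs hV hlim
  have := hd.continuousOn.continuousAt (Metric.ball_mem_nhds a hs)
  exact hσ.isEmbedding.isInducing.continuousAt_iff.2 this

/-- Surjectivity onto `K` passes to the limit by compactness. -/
theorem ConvergesNear.image_eq {V K : Set ℂ} {f : ℕ → ℂ → ℂ} {F : ℂ → ℂ} (hK : IsCompact K)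
    (h : ConvergesNear V K f F) : F '' K = K := by
  refine Subset.antisymm ?_ fun y hy => ?_
  · rintro _ ⟨a, ha, rfl⟩
    refine hK.isClosed.mem_of_tendsto (h.tendsto_apply ha) (Filter.Eventually.of_forall fun n => ?_)
    rw [← (h.selfMap n).image_eq]; exact mem_image_of_mem _ ha
  · have hx : ∀ n, ∃ x ∈ K, f n x = y := fun n => by
      rw [← (h.selfMap n).image_eq] at hy; exact hy
    choose x hxK hxy using hx
    obtain ⟨x₀, hx₀, u, hu, hlim⟩ := hK.tendsto_subseq hxK
    obtain ⟨s, hs, -, hunif⟩ := h.tendsto x₀ hx₀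
    have ht := tendsto_comp_of_locally_uniform_limit (F := fun n => f (u n)) (p := Filter.atTop)
      (h.continuousAt hx₀) hlim fun v hv => ⟨_, Metric.ball_mem_nhds x₀ hs,
        hu.tendsto_atTop.eventually (hunif v hv)⟩
    have ht' : Filter.Tendsto (fun _ : ℕ => y) Filter.atTop (𝓝 (F x₀)) := by
      refine ht.congr fun n => ?_
      exact hxy (u n)
    exact ⟨x₀, hx₀, tendsto_nhds_unique ht' tendsto_const_nhds⟩

/-- Every point of `K` is the value of the limit at a point of `K` where it is not locally constant:
the other points form a compact set on which `F` has finitely many values, and a compact set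
containing all but finitely many points of the perfect set `K` contains `K`. -/
theorem ConvergesNear.exists_not_locally_const {V K : Set ℂ} {f : ℕ → ℂ → ℂ} {F : ℂ → ℂ}
    (hK : IsCompact K) (hacc : ∀ x ∈ K, AccPt x (Filter.principal K))
    (h : ConvergesNear V K f F) {y : ℂ} (hy : y ∈ K) :
    ∃ a ∈ K, F a = y ∧ ¬ ∀ᶠ z in 𝓝 a, F z = F a := by
  set N : Set ℂ := {a | ∀ᶠ z in 𝓝 a, F z = F a} with hN
  have hNopen : IsOpen N := by
    rw [isOpen_iff_mem_nhds]
    intro a ha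
    have ha' : ∀ᶠ z in 𝓝 a, F z = F a := ha
    filter_upwards [eventually_eventually_nhds.2 ha', ha'] with w hw hwa
    show ∀ᶠ z in 𝓝 w, F z = F w
    rw [hwa]; exact hw
  have hFc : ContinuousOn F K := fun a ha => (h.continuousAt ha).continuousWithinAt
  have hA : IsCompact (F '' (K \ N)) := (hK.diff hNopen).image_of_continuousOn
    (hFc.mono sdiff_subset)
  have hBclosed : IsClosed (K ∩ N) := by
    refine isClosed_of_closure_subset fun a ha => ?_
    have haK : a ∈ K := hK.isClosed.closure_subset (closure_mono inter_subset_left ha)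
    obtain ⟨s, hs, hV, hlim⟩ := h.tendsto a haK
    obtain ⟨σ, hσ, hd, -⟩ := exists_isometry_differentiableOn h.selfMap hs hV hlim
    obtain ⟨b, hb, hbK, hbN⟩ := mem_closure_iff.1 ha _ Metric.isOpen_ball (Metric.mem_ball_self hs)
    have hc := eqOn_const_of_eventually_eq hσ hd hb hbN
    refine ⟨haK, ?_⟩
    filter_upwards [Metric.ball_mem_nhds a hs] with z hz
    rw [hc z hz, hc a (Metric.mem_ball_self hs)]
  have hBfin : (F '' (K ∩ N)).Finite := by
    obtain ⟨t, -, ht⟩ := (hK.of_isClosed_subset hBclosed inter_subset_left).elim_nhds_subcover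
      (fun a => {z | F z = F a}) fun a ha => ha.2
    refine (t.finite_toSet.image F).subset ?_
    rintro _ ⟨b, hb, rfl⟩
    obtain ⟨a, ha, hba⟩ := mem_iUnion₂.1 (ht hb)
    exact ⟨a, ha, hba.symm⟩
  suffices y ∈ F '' (K \ N) by
    obtain ⟨a, ha, hay⟩ := this
    exact ⟨a, ha.1, hay, ha.2⟩
  by_contra hyA
  have hn : (F '' (K \ N))ᶜ ∩ (F '' (K ∩ N) \ {y})ᶜ ∈ 𝓝 y :=
    Filter.inter_mem (hA.isClosed.isOpen_compl.mem_nhds hyA)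
      ((hBfin.subset sdiff_subset).isClosed.isOpen_compl.mem_nhds fun hc => hc.2 rfl)
  obtain ⟨z, ⟨⟨hz1, hz2⟩, hzK⟩, hzy⟩ := accPt_iff_nhds.1 (hacc y hy) _ hn
  rw [← h.image_eq hK] at hzK
  obtain ⟨x, hx, rfl⟩ := hzK
  by_cases hxN : x ∈ N
  · exact hz2 ⟨⟨x, ⟨hx, hxN⟩, rfl⟩, hzy⟩
  · exact hz1 ⟨x, ⟨hx, hxN⟩, rfl⟩

/-- A Hurwitz argument: if `F` is not locally constant at `a`, then the injective maps `f n` already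
take all values near `F a` on any given small disc about `a`. -/
theorem ConvergesNear.eq_of_apply_eq {V K : Set ℂ} {f : ℕ → ℂ → ℂ} {F : ℂ → ℂ}
    (hKV : K ⊆ V) (h : ConvergesNear V K f F) {a b : ℂ} (ha : a ∈ K) (hb : b ∈ K)
    (hab : F a = F b) (hna : ¬ ∀ᶠ z in 𝓝 a, F z = F a) : a = b := by
  by_contra hne
  obtain ⟨s, hs, hV, hlim⟩ := h.tendsto a ha
  obtain ⟨σ, hσ, hd, hfreq⟩ := exists_isometry_differentiableOn h.selfMap hs hV hlim
  have haB := Metric.mem_ball_self (x := a) hs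
  have hev : ∀ᶠ z in 𝓝[≠] a, σ (F z) ≠ σ (F a) := by
    rcases (hd.analyticOnNhd Metric.isOpen_ball a haB).eventually_eq_or_eventually_ne
      (analyticAt_const (v := σ (F a))) with h1 | h1
    · exact absurd (h1.mono fun z hz => hσ.injective hz) hna
    · exact h1
  rw [eventually_nhdsWithin_iff, Metric.eventually_nhds_iff] at hev
  obtain ⟨τ, hτ, hτne⟩ := hev
  -- a circle about `a` on which the limit avoids `F a`, too small to enclose `b`
  obtain ⟨r, hr0, hr⟩ := exists_between (show 0 < min τ (min s (dist b a)) from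
    lt_min hτ (lt_min hs (dist_pos.2 (Ne.symm hne))))
  have hrτ : r < τ := hr.trans_le (min_le_left _ _)
  have hrs : r < s := hr.trans_le ((min_le_right _ _).trans (min_le_left _ _))
  have hrb : r < dist b a := hr.trans_le ((min_le_right _ _).trans (min_le_right _ _))
  have hsph : Metric.sphere a r ⊆ Metric.ball a s := fun z hz => by
    rw [Metric.mem_ball, Metric.mem_sphere.1 hz]; exact hrs
  obtain ⟨w₀, hw₀, hmin⟩ := (isCompact_sphere a r).exists_isMinOn
    (NormedSpace.sphere_nonempty.2 hr0.le)
    (f := fun z => ‖σ (F z) - σ (F a)‖)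
    ((hd.continuousOn.mono hsph).sub continuousOn_const).norm
  set ε := ‖σ (F w₀) - σ (F a)‖ with hε
  have hε0 : 0 < ε := by
    refine norm_pos_iff.2 (sub_ne_zero.2 (hτne ?_ ?_))
    · rw [Metric.mem_sphere.1 hw₀]; exact hrτ
    · rintro rfl; rw [Metric.mem_sphere, dist_self] at hw₀; linarith
  have e1 := Metric.tendstoUniformlyOn_iff.1 hlim (ε / 8) (by positivity)
  have e2 := Metric.tendsto_nhds.1 (h.tendsto_apply hb) (ε / 8) (by positivity)
  obtain ⟨n, hn, h1, h2⟩ := (hfreq.and_eventually (e1.and e2)).exists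
  have h3 := h1 a haB
  have himg := ball_subset_image_closedBall (r := r) (ε := ε / 2) hn hr0 hrs (by positivity) (by
    intro z hz
    have h4 := h1 z (hsph hz)
    have h5 : ε ≤ dist (F z) (F a) := by
      have : ε ≤ ‖σ (F z) - σ (F a)‖ := hmin hz
      rwa [← dist_eq_norm, hσ.dist_eq] at this
    rw [← dist_eq_norm, hσ.dist_eq]
    have h6 := dist_triangle4 (F z) (f n z) (f n a) (F a)
    rw [dist_comm (f n a)] at h6
    linarith)
  obtain ⟨w, hw, hwe⟩ := himg (show σ (f n b) ∈ _ by
    rw [Metric.mem_ball, hσ.dist_eq]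
    have := dist_triangle (f n b) (F a) (f n a)
    rw [hab] at this h3
    linarith)
  have hwb : w = b := (h.selfMap n).injOn
    (hV (Metric.closedBall_subset_ball hrs hw)) (hKV hb) (hσ.injective hwe)
  rw [hwb, Metric.mem_closedBall] at hw
  linarith

theorem ConvergesNear.not_locally_const {V K : Set ℂ} {f : ℕ → ℂ → ℂ} {F : ℂ → ℂ}
    (hK : IsCompact K) (hacc : ∀ x ∈ K, AccPt x (Filter.principal K)) (hKV : K ⊆ V)
    (h : ConvergesNear V K f F) {b : ℂ} (hb : b ∈ K) : ¬ ∀ᶠ z in 𝓝 b, F z = F b := by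
  have hFb : F b ∈ K := by
    rw [← h.image_eq hK]; exact mem_image_of_mem F hb
  obtain ⟨a, ha, hab, hna⟩ := h.exists_not_locally_const hK hacc hFb
  rwa [← h.eq_of_apply_eq hKV ha hb hab hna]

/-! ### Quotients of nearby self-maps are small symmetries -/

/-- Two close functions `p` and `q`, of which `p` expands distances at least by `κ`, differ by a
holomorphic map `g = p⁻¹ ∘ q` close to the identity. -/
theorem exists_comparison {p q : ℂ → ℂ} {b : ℂ} {ρ κ η : ℝ} (hκ : 0 < κ) (hρ : 0 < ρ)
    (hp : DifferentiableOn ℂ p (Metric.ball b ρ)) (hq : DifferentiableOn ℂ q (Metric.ball b ρ))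
    (hp' : ∀ z ∈ Metric.ball b ρ, deriv p z ≠ 0)
    (hexp : ∀ z ∈ Metric.ball b ρ, ∀ w ∈ Metric.ball b ρ, κ * ‖z - w‖ ≤ ‖p z - p w‖)
    (hη : η ≤ κ * ρ / 8) (hpq : ∀ z ∈ Metric.ball b ρ, ‖q z - p z‖ < η) :
    ∃ g : ℂ → ℂ, DifferentiableOn ℂ g (Metric.ball b (ρ / 2)) ∧
      ∀ x ∈ Metric.ball b (ρ / 2), g x ∈ Metric.ball b ρ ∧ p (g x) = q x ∧ κ * ‖g x - x‖ < η := by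
  have hsub : Metric.ball b (ρ / 2) ⊆ Metric.ball b ρ := Metric.ball_subset_ball (by linarith)
  have hsol : ∀ x ∈ Metric.ball b (ρ / 2), ∃ y ∈ Metric.ball b ρ, p y = q x := by
    intro x hx
    have hxρ : Metric.ball x (ρ / 2) ⊆ Metric.ball b ρ := fun y hy => by
      rw [Metric.mem_ball] at *
      linarith [dist_triangle y x b]
    have himg := ball_subset_image_closedBall (f := p) (a := x) (s := ρ / 2) (r := ρ / 4)
      (ε := κ * (ρ / 4)) (hp.mono hxρ) (by linarith) (by linarith) (by positivity) (by
        intro z hz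
        have h1 := hexp z (hxρ (by rw [Metric.mem_ball, Metric.mem_sphere.1 hz]; linarith))
          x (hsub hx)
        rwa [← dist_eq_norm z x, Metric.mem_sphere.1 hz] at h1)
    obtain ⟨y, hy, hye⟩ := himg (show q x ∈ _ by
      rw [mem_ball_iff_norm]
      have := hpq x (hsub hx)
      linarith)
    exact ⟨y, hxρ (Metric.closedBall_subset_ball (by linarith) hy), hye⟩
  choose! g hgB hgp using hsol
  refine ⟨g, fun x hx => ?_, fun x hx => ⟨hgB x hx, hgp x hx, ?_⟩⟩
  · have hcont : ContinuousAt g x := by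
      have hqc : ContinuousAt q x :=
        hq.continuousOn.continuousAt (Metric.isOpen_ball.mem_nhds (hsub hx))
      rw [Metric.continuousAt_iff'] at hqc ⊢
      intro ε hε
      filter_upwards [hqc (κ * ε) (by positivity), Metric.isOpen_ball.mem_nhds hx] with y hy hyB
      have h1 := hexp _ (hgB y hyB) _ (hgB x hx)
      rw [hgp y hyB, hgp x hx, ← dist_eq_norm, ← dist_eq_norm] at h1
      exact lt_of_mul_lt_mul_left (h1.trans_lt hy) hκ.le
    refine (HasDerivAt.of_comp_left (f := p) (h := q) hcont
      (hp.differentiableAt (Metric.isOpen_ball.mem_nhds (hgB x hx))).hasDerivAt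
      (hq.differentiableAt (Metric.isOpen_ball.mem_nhds (hsub hx))).hasDerivAt
      (hp' _ (hgB x hx)) ?_).differentiableAt.differentiableWithinAt
    filter_upwards [Metric.isOpen_ball.mem_nhds hx] with y hy
    exact hgp y hy
  · have h1 := hexp _ (hgB x hx) x (hsub hx)
    rw [hgp x hx] at h1
    exact h1.trans_lt (hpq x (hsub hx))

/-- If the limit has nonzero derivative at `b`, then on a fixed disc about `b` almost all
functions of the sequence expand distances by at least a fixed factor. -/
theorem exists_uniform_expansion {h : ℕ → ℂ → ℂ} {G : ℂ → ℂ} {b : ℂ} {ρ : ℝ} (hρ : 0 < ρ)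
    (hh : ∀ n, DifferentiableOn ℂ (h n) (Metric.ball b ρ))
    (hlim : TendstoUniformlyOn h G Filter.atTop (Metric.ball b ρ)) (hG : deriv G b ≠ 0) :
    ∃ r > 0, r ≤ ρ ∧ ∃ κ > 0, ∀ᶠ n in Filter.atTop, (∀ z ∈ Metric.ball b r, deriv (h n) z ≠ 0) ∧
      ∀ z ∈ Metric.ball b r, ∀ w ∈ Metric.ball b r, κ * ‖z - w‖ ≤ ‖h n z - h n w‖ := by
  set c := deriv G b with hc
  have hc0 : 0 < ‖c‖ := norm_pos_iff.2 hG
  have hGd : DifferentiableOn ℂ G (Metric.ball b ρ) :=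
    hlim.tendstoLocallyUniformlyOn.differentiableOn (Filter.Eventually.of_forall hh)
      Metric.isOpen_ball
  have hbB := Metric.mem_ball_self (x := b) hρ
  have hcont : ContinuousAt (deriv G) b :=
    ((hGd.analyticOnNhd Metric.isOpen_ball).deriv b hbB).continuousAt
  obtain ⟨r₁, hr₁, hr₁c⟩ := Metric.continuousAt_iff.1 hcont (‖c‖ / 4) (by positivity)
  set r := min (r₁ / 2) (ρ / 2) with hr
  have hr0 : 0 < r := by positivity
  have hrρ : r ≤ ρ / 2 := min_le_right _ _
  have hrr : r ≤ r₁ / 2 := min_le_left _ _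
  have hder := hlim.tendstoLocallyUniformlyOn.deriv (Filter.Eventually.of_forall hh)
    Metric.isOpen_ball
  have hder' := (tendstoLocallyUniformlyOn_iff_forall_isCompact Metric.isOpen_ball).1 hder
    (Metric.closedBall b r) (Metric.closedBall_subset_ball (by linarith)) (isCompact_closedBall _ _)
  have hsub : Metric.ball b r ⊆ Metric.ball b ρ := Metric.ball_subset_ball (by linarith)
  refine ⟨r, hr0, by linarith, ‖c‖ / 2, by positivity, ?_⟩
  filter_upwards [Metric.tendstoUniformlyOn_iff.1 hder' (‖c‖ / 4) (by positivity)] with n hn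
  have hclose : ∀ z ∈ Metric.ball b r, ‖deriv (h n) z - c‖ ≤ ‖c‖ / 2 := by
    intro z hz
    have h1 := hn z (Metric.ball_subset_closedBall hz)
    have h2 := hr₁c (show dist z b < r₁ by rw [Metric.mem_ball] at hz; linarith)
    rw [← dist_eq_norm]
    have h3 := dist_triangle (deriv (h n) z) (deriv G z) c
    rw [dist_comm] at h1
    simp only [Function.comp_apply] at h1
    linarith
  refine ⟨fun z hz h0 => ?_, fun z hz w hw => ?_⟩
  · have := hclose z hz
    rw [h0, zero_sub, norm_neg] at this
    linarith
  · have hd : ∀ x ∈ Metric.ball b r, HasDerivWithinAt (fun x => h n x - c * x)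
        (deriv (h n) x - c) (Metric.ball b r) x := by
      intro x hx
      have h1 := ((hh n).differentiableAt (Metric.isOpen_ball.mem_nhds (hsub hx))).hasDerivAt
      have h2 := (hasDerivAt_id x).const_mul c
      rw [mul_one] at h2
      exact (h1.sub h2).hasDerivWithinAt
    have h1 := (convex_ball b r).norm_image_sub_le_of_norm_hasDerivWithin_le hd hclose hw hz
    have e : c * (z - w) = (h n z - h n w) - ((h n z - c * z) - (h n w - c * w)) := by ring
    have h2 : ‖c‖ * ‖z - w‖ ≤ ‖h n z - h n w‖ + ‖c‖ / 2 * ‖z - w‖ := by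
      rw [← norm_mul, e]
      exact (norm_sub_le _ _).trans (by gcongr)
    linarith

/-- The zeros of the derivative are isolated, so a dense set of attracting points avoids them. -/
theorem exists_attracting_deriv_ne_zero {K : Set ℂ} {G : ℂ → ℂ} {x₀ : ℂ} {s : ℝ} (hs : 0 < s)
    (hG : DifferentiableOn ℂ G (Metric.ball x₀ s)) (hnc : ¬ ∀ᶠ z in 𝓝 x₀, G z = G x₀)
    (hacc : AccPt x₀ (Filter.principal K)) (hdense : K ⊆ closure (attractingPts K ∩ K)) :
    ∃ b ∈ attractingPts K ∩ K, b ∈ Metric.ball x₀ s ∧ deriv G b ≠ 0 := by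
  have hx₀ := Metric.mem_ball_self (x := x₀) hs
  have han := hG.analyticOnNhd Metric.isOpen_ball
  have hev : ∀ᶠ z in 𝓝[≠] x₀, deriv G z ≠ 0 := by
    rcases (han.deriv x₀ hx₀).eventually_eq_or_eventually_ne (analyticAt_const (v := (0 : ℂ)))
      with h | h
    · refine absurd ?_ hnc
      have h0 := han.deriv.eqOn_of_preconnected_of_eventuallyEq analyticOnNhd_const
        (convex_ball _ _).isPreconnected hx₀ h
      filter_upwards [Metric.ball_mem_nhds x₀ hs] with z hz
      exact Metric.isOpen_ball.is_const_of_deriv_eq_zero (convex_ball _ _).isPreconnected hG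
        h0 hz hx₀
    · exact h
  rw [eventually_nhdsWithin_iff, Metric.eventually_nhds_iff] at hev
  obtain ⟨τ, hτ, hne⟩ := hev
  obtain ⟨y, ⟨hyB, hyK⟩, hyx⟩ := accPt_iff_nhds.1 hacc _
    (Metric.ball_mem_nhds x₀ (lt_min hτ hs))
  obtain ⟨b, ⟨hb1, hb2⟩, hb3⟩ := mem_closure_iff.1 (hdense hyK) _
    (Metric.isOpen_ball.inter isOpen_compl_singleton)
    (show y ∈ Metric.ball x₀ (min τ s) ∩ {x₀}ᶜ from ⟨hyB, hyx⟩)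
  rw [Metric.mem_ball, lt_min_iff] at hb1
  exact ⟨b, hb3, hb1.2, hne hb1.1 hb2⟩

/-- A set whose closure contains `K` accumulates wherever `K` does. -/
theorem accPt_inter_of_dense {K A : Set ℂ} {b : ℂ} (hacc : AccPt b (Filter.principal K))
    (hdense : K ⊆ closure A) : AccPt b (Filter.principal A) := by
  rw [accPt_iff_nhds]
  intro U hU
  obtain ⟨y, ⟨hyU, hyK⟩, hyb⟩ := accPt_iff_nhds.1 hacc _ (interior_mem_nhds.2 hU)
  obtain ⟨a, ⟨ha1, ha2⟩, ha3⟩ := mem_closure_iff.1 (hdense hyK) _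
    (isOpen_interior.inter isOpen_compl_singleton) (show y ∈ interior U ∩ {b}ᶜ from ⟨hyU, hyb⟩)
  exact ⟨a, ⟨interior_subset ha1, ha3⟩, ha2⟩

/-- The quotients `(f m)⁻¹ ∘ f (m + 1)` are nontrivial small symmetries of `K` on a fixed disc. The
isometry `σ`, the identity or the conjugation, makes all the maps holomorphic on `C`. -/
theorem ConvergesNear.exists_smallSym {V K C : Set ℂ} {f : ℕ → ℂ → ℂ} {F σ : ℂ → ℂ}
    (hKV : K ⊆ V) (hf : ConvergesNear V K f F) (hC : IsOpen C) (hCc : IsPreconnected C)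
    (hCV : C ⊆ V) (hσ : Isometry σ)
    (hd : ∀ n, DifferentiableOn ℂ (fun z => σ (f n z)) C)
    (hne : ∀ m n, m ≠ n → ¬ EqOn (f m) (f n) C) {b : ℂ} {ρ : ℝ} (hρ : 0 < ρ)
    (hρC : Metric.ball b ρ ⊆ C)
    (hlim : TendstoUniformlyOn f F Filter.atTop (Metric.ball b ρ))
    (hderiv : deriv (fun z => σ (F z)) b ≠ 0) :
    ∃ r > 0, ∀ ε > 0, ∃ g, SmallSym K b r ε g ∧ ∃ z ∈ Metric.ball b r, g z ≠ z := by
  have hlim' : TendstoUniformlyOn (fun n z => σ (f n z)) (fun z => σ (F z)) Filter.atTop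
      (Metric.ball b ρ) := hσ.uniformContinuous.comp_tendstoUniformlyOn hlim
  obtain ⟨r, hr, hrρ, κ, hκ, hexp⟩ := exists_uniform_expansion hρ (fun n => (hd n).mono hρC)
    hlim' hderiv
  have hrC : Metric.ball b r ⊆ C := (Metric.ball_subset_ball hrρ).trans hρC
  refine ⟨r / 2, half_pos hr, fun ε hε => ?_⟩
  set η := min (κ * ε) (κ * r / 8) with hη
  have hη0 : 0 < η := by positivity
  have hev := hexp.and (Metric.tendstoUniformlyOn_iff.1 hlim' (η / 2) (half_pos hη0))
  obtain ⟨m, hm⟩ := Filter.eventually_atTop.1 hev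
  obtain ⟨⟨hm1, hm2⟩, hm3⟩ := hm m le_rfl
  have hn3 := (hm (m + 1) (Nat.le_succ m)).2
  obtain ⟨g, hgd, hg⟩ := exists_comparison (p := fun z => σ (f m z))
    (q := fun z => σ (f (m + 1) z)) hκ hr ((hd m).mono hrC) ((hd (m + 1)).mono hrC) hm1 hm2
    (min_le_right _ _) (fun z hz => by
      have hz' := Metric.ball_subset_ball hrρ hz
      have h1 := hm3 z hz'
      have h2 := hn3 z hz'
      rw [← dist_eq_norm]
      calc dist (σ (f (m + 1) z)) (σ (f m z))
          ≤ dist (σ (F z)) (σ (f (m + 1) z)) + dist (σ (F z)) (σ (f m z)) :=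
            dist_triangle_left _ _ _
        _ < η / 2 + η / 2 := add_lt_add h2 h1
        _ = η := add_halves η)
  have hsub : Metric.ball b (r / 2) ⊆ Metric.ball b r := Metric.ball_subset_ball (by linarith)
  refine ⟨g, ⟨hgd, fun x hx => ?_, fun x hx => ?_⟩, ?_⟩
  · have h1 := (hg x hx).2.2.trans_le (min_le_left (κ * ε) _)
    exact lt_of_mul_lt_mul_left h1 hκ.le
  · obtain ⟨h1, h2, -⟩ := hg x hx
    have h3 : f m (g x) = f (m + 1) x := hσ.injective h2
    rw [(hf.selfMap m).mem_iff hKV (hCV (hrC h1)), h3,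
      ← (hf.selfMap (m + 1)).mem_iff hKV (hCV (hrC (hsub hx)))]
  · by_contra hid
    push Not at hid
    refine hne m (m + 1) (Nat.succ_ne_self m).symm fun z hz => hσ.injective ?_
    refine ((hd m).analyticOnNhd hC).eqOn_of_preconnected_of_eventuallyEq
      ((hd (m + 1)).analyticOnNhd hC) hCc (hρC (Metric.mem_ball_self hρ)) ?_ hz
    filter_upwards [Metric.ball_mem_nhds b (half_pos hr)] with x hx
    have := (hg x hx).2.1
    rwa [hid x hx] at this

end PlaneSymmetry

open PlaneSymmetry in
theorem theorem2p4 (K V : Set ℂ) (hK : IsCompact K)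
    (hacc : ∀ x ∈ K, AccPt x (Filter.principal K))
    (hJ : PlaneSymmetry.IsJLike K) (hL : PlaneSymmetry.IsNonLaminar K)
    (hV : IsOpen V) (hKV : K ⊆ V)
    (hcomp : ∀ x ∈ V, (connectedComponentIn V x ∩ K).Nonempty) :
    (PlaneSymmetry.conformalSelfMaps V K).Finite := by
  by_contra hinf
  have hdense : K ⊆ closure (attractingPts K ∩ K) := by
    obtain ⟨U, hKU, -, hU⟩ := hJ
    rwa [inter_eq_self_of_subset_right hKU] at hU
  obtain ⟨x₀, hx₀, f, hf, hne, htype⟩ := exists_seq_of_infinite hK hV hKV hcomp hinf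
  obtain ⟨u, F, hu, hlim⟩ := exists_subseq_tendstoUniformlyOn hK hacc hV hKV hf
  have hconv : ConvergesNear V K (fun n => f (u n)) F := ⟨fun n => hf _, hlim⟩
  obtain ⟨σ, hσ, hd⟩ : ∃ σ : ℂ → ℂ, Isometry σ ∧
      ∀ n, DifferentiableOn ℂ (fun z => σ (f n z)) (connectedComponentIn V x₀) := by
    rcases htype with h | h
    · exact ⟨id, isometry_id, h⟩
    · exact ⟨_, Complex.isometry_conj, h⟩
  obtain ⟨s, hs, hsV, hslim⟩ := hlim x₀ hx₀
  have hsC : Metric.ball x₀ s ⊆ connectedComponentIn V x₀ :=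
    (convex_ball x₀ s).isPreconnected.subset_connectedComponentIn (Metric.mem_ball_self hs) hsV
  have hFd : DifferentiableOn ℂ (fun z => σ (F z)) (Metric.ball x₀ s) :=
    differentiableOn_of_frequently Metric.isOpen_ball
      (hσ.uniformContinuous.comp_tendstoUniformlyOn hslim)
      (Filter.Eventually.of_forall fun n => (hd (u n)).mono hsC).frequently
  obtain ⟨b, ⟨hba, hbK⟩, hbs, hb⟩ := exists_attracting_deriv_ne_zero hs hFd
    (fun h => hconv.not_locally_const hK hacc hKV hx₀ (h.mono fun z hz => hσ.injective hz))
    (hacc x₀ hx₀) hdense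
  obtain ⟨ρ, hρ, hρs⟩ := Metric.mem_nhds_iff.1 (Metric.isOpen_ball.mem_nhds hbs)
  obtain ⟨r, hr, hsm⟩ := hconv.exists_smallSym hKV hV.connectedComponentIn
    isPreconnected_connectedComponentIn (connectedComponentIn_subset V x₀) hσ (fun n => hd (u n))
    (fun m n hmn => hne _ _ (hu.injective.ne hmn)) hρ (hρs.trans hsC) (hslim.mono hρs) hb
  obtain ⟨U, hU⟩ := exists_isLaminarRel hK.isClosed hbK hba
    (accPt_inter_of_dense (hacc b hbK) hdense) hr hsm
  exact hL U hU
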